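/- **Setting.** Let $E$ be a CW complex and choose an orientation of every cell. Write $\mathcal E_i$ for the set of $i$-cells ($\mathcal E_{-1}=\emptyset$) and $d_{\alpha\beta}\in\mathbb Z$ for the incidence number of $\alpha\in\mathcal E_{i+1}$ and $\beta\in\mathcal E_i$, i.e. the coefficient of $\beta$ in the cellular boundary of $\alpha$. Assume that for every cell $\beta\in\mathcal E_i$ the set $\{\alpha\in\mathcal E_{i+1} : d_{\alpha\beta}\ne0\}$ is finite. Let $G$ be a finite abelian group, $\hat G=\mathrm{Hom}(G,\mathbb Q/\mathbb Z)$ and $n\in\mathbb N$. Let $C_i(E;\hat G)=\bigoplus_{\alpha\in\mathcal E_i}\hat G$ and $C^i_{\mathrm{lf}}(E;G)=\bigoplus_{\alpha\in\mathcal E_i}G$, with $$\partial\Big(\sum_\alpha\chi_\alpha e_\alpha\Big)=\sum_\beta\Big(\sum_\alpha d_{\alpha\beta}\chi_\alpha\Big)e_\beta,\qquad \partial^T\Big(\sum_\beta g_\beta e_\beta\Big)=\sum_\alpha\Big(\sum_\beta d_{\alpha\beta}g_\beta\Big)e_\alpha ,$$ and let $H_n(E;\hat G)$ and $H^n_{\mathrm{lf}}(E;G)$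 be the homology of these two complexes in degree $n$. The pairing $\langle\sum\chi_\alpha e_\alpha,\sum g_\alpha e_\alpha\rangle=\sum\chi_\alpha(g_\alpha)\in\mathbb Q/\mathbb Z$ induces a pairing of $H_n(E;\hat G)$ and $H^n_{\mathrm{lf}}(E;G)$. Let $\mathfrak A$ be the quasi-local C*-algebra with set of sites $\mathcal E_n$ and Hilbert space $\ell^2(G)$ at every site, i.e. the C*-algebraic direct limit of the algebras $B(\ell^2(G)^{\otimes\Lambda})$ over the finite sets $\Lambda\subseteq\mathcal E_n$. For $a=\sum g_\alpha e_\alpha\in C^n_{\mathrm{lf}}(E;G)$ and $b=\sum\chi_\alpha e_\alpha\in C_n(E;\hat G)$ let $X^a,Z^b\in\mathfrak A$ be the unitaries acting at each site $\alpha$ as $|h\rangle\mapsto|h+g_\alpha\rangle$ and $|h\rangle\mapsto e^{2\pi i\chi_\alpha(h)}|h\rangle$, respectively. Let * $\mathfrak A_{XZ}$ be the closed linear span of all $X^{\partial^Tc}Z^{\partial d}$ with $c\in C^{n-1}_{\mathrm{lf}}(E;G)$, $d\in C_{n+1}(E;\hat G)$, and $\mathfrak A_{XZ}'$ its commutant in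 $\mathfrak A$; * $J\subseteq\mathfrak A_{XZ}'$ be the closed linear span of all $X^aZ^b-X^{a+\partial^Tc}Z^{b+\partial d}$ with $\partial^Ta=0$, $\partial b=0$, which is a closed two-sided $*$-ideal; $\mathfrak A_{\mathrm{logical}}=\mathfrak A_{XZ}'/J$, with quotient map $p$. For $\alpha\in\mathcal E_{n-1}$ and $\beta\in\mathcal E_{n+1}$ put $A_\alpha=\frac1{|G|}\sum_{g\in G}X^{\partial^T(ge_\alpha)}$ and $B_\beta=\frac1{|G|}\sum_{\chi\in\hat G}Z^{\partial(\chi e_\beta)}$. A frustration-free ground state is a state $\omega$ of $\mathfrak A$ with $\omega(A_\alpha)=1$ and $\omega(B_\beta)=1$ for all $\alpha\in\mathcal E_{n-1}$, $\beta\in\mathcal E_{n+1}$ (it minimizes every term $-A_\alpha$, $-B_\beta$ of the Hamiltonian). **Theorem 6.4.** Suppose that $H_n(E;\hat G)$ and $H^n_{\mathrm{lf}}(E;G)$ are finite. 1. There is a bijection $\omega\mapsto\tilde\omega$ from the frustration-free ground states onto the states of $\mathfrak A_{\mathrm{logical}}$ such that $\tilde\omega(p(T))=\omega(T)$ for all $T\in\mathfrak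 A_{XZ}'$. 2. Let $$c=\log_2\big|\{x\in H_n(E;\hat G):\langle x,y\rangle=0\ \forall y\in H^n_{\mathrm{lf}}(E;G)\}\big|+\log_2\big|\{y\in H^n_{\mathrm{lf}}(E;G):\langle x,y\rangle=0\ \forall x\in H_n(E;\hat G)\}\big|,$$ $$q=\tfrac12\big(\log_2|H_n(E;\hat G)\times H^n_{\mathrm{lf}}(E;G)|-c\big).$$ Then $2^c$ and $2^q$ are natural numbers and there is a $*$-isomorphism $$\mathfrak A_{\mathrm{logical}}\simeq\mathbb C^{2^c}\otimes B(\mathbb C^{2^q}),$$ where $\mathbb C^{2^c}$ carries the pointwise operations. -/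

import Mathlib

open scoped TensorProduct

universe u v

noncomputable section

namespace KitaevModel

open Topology (CWComplex)
open Topology.RelCWComplex (cell closedCell cellFrontier skeletonLT)

section SingularChains

open scoped CategoryTheory

variable (X : Type u) [TopologicalSpace X]

/-- The singular chain complex of `X` with integer coefficients. -/
def singularChains : ChainComplex AddCommGrpCat.{u} ℕ :=
  ((AlgebraicTopology.singularChainComplexFunctor AddCommGrpCat.{u}).obj
    (AddCommGrpCat.of (ULift.{u} ℤ))).obj (TopCat.of X)

variable {X}

/-- The chain map induced by the inclusion of a subspace. -/
def singularChainsInclusion (A : Set X) : singularChains A ⟶ singularChains X :=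
  ((AlgebraicTopology.singularChainComplexFunctor AddCommGrpCat.{u}).obj
    (AddCommGrpCat.of (ULift.{u} ℤ))).map (TopCat.ofHom ⟨Subtype.val, continuous_subtype_val⟩)

/-- The singular `i`-chains of `X` that lie in the subspace `A`. -/
def chainsIn (A : Set X) (i : ℕ) : AddSubgroup ((singularChains X).X i) :=
  ((singularChainsInclusion A).f i).hom.range

/-- The singular boundary operator. -/
def singularBoundary (i j : ℕ) : (singularChains X).X i →+ (singularChains X).X j :=
  ((singularChains X).d i j).hom

/-- Relative singular cycles of the pair `(A, B)`: chains in `A` whose boundary lies in `B`.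
(For `i = 0` the operator `singularBoundary 0 0` is zero, so every `0`-chain in `A` is a cycle.) -/
def relCycles (A B : Set X) (i : ℕ) : AddSubgroup ((singularChains X).X i) :=
  chainsIn A i ⊓ (chainsIn B (i - 1)).comap (singularBoundary i (i - 1))

/-- Relative singular boundaries of the pair `(A, B)`. -/
def relBoundaries (A B : Set X) (i : ℕ) : AddSubgroup ((singularChains X).X i) :=
  (chainsIn A (i + 1)).map (singularBoundary (i + 1) i) ⊔ chainsIn B i

/-- The relative singular homology group `H_i(A, B; ℤ)` of subspaces `B ⊆ A` of `X`. -/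
abbrev RelHomology (A B : Set X) (i : ℕ) : Type u :=
  ↥(relCycles A B i) ⧸ (relBoundaries A B i).addSubgroupOf (relCycles A B i)

lemma singularBoundary_comp (i j k : ℕ) (x : (singularChains X).X i) :
    singularBoundary j k (singularBoundary i j x) = 0 :=
  congrArg (fun f => f.hom x) ((singularChains X).d_comp_d i j k)

lemma chainsIn_mono {A B : Set X} (h : A ⊆ B) (i : ℕ) : chainsIn A i ≤ chainsIn B i := by
  rintro _ ⟨y, rfl⟩
  let S := (AlgebraicTopology.singularChainComplexFunctor AddCommGrpCat.{u}).obj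
    (AddCommGrpCat.of (ULift.{u} ℤ))
  let j : TopCat.of A ⟶ TopCat.of B := TopCat.ofHom ⟨Set.inclusion h, continuous_inclusion h⟩
  refine ⟨((S.map j).f i).hom y, ?_⟩
  have e : S.map j ≫ singularChainsInclusion B = singularChainsInclusion A :=
    (S.map_comp j (TopCat.ofHom ⟨Subtype.val, continuous_subtype_val⟩)).symm
  rw [← e]
  rfl

lemma singularBoundary_mem {A : Set X} {i : ℕ} (j : ℕ) {x : (singularChains X).X i}
    (hx : x ∈ chainsIn A i) : singularBoundary i j x ∈ chainsIn A j := by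
  obtain ⟨y, rfl⟩ := hx
  exact ⟨((singularChains A).d i j).hom y,
    (congrArg (fun f => f.hom y) ((singularChainsInclusion A).comm i j)).symm⟩

lemma relCycles_mono {A B A' B' : Set X} (hA : A ⊆ A') (hB : B ⊆ B') (i : ℕ) :
    relCycles A B i ≤ relCycles A' B' i :=
  inf_le_inf (chainsIn_mono hA i) (AddSubgroup.comap_mono (chainsIn_mono hB _))

lemma relBoundaries_mono {A B A' B' : Set X} (hA : A ⊆ A') (hB : B ⊆ B') (i : ℕ) :
    relBoundaries A B i ≤ relBoundaries A' B' i :=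
  sup_le_sup (AddSubgroup.map_mono (chainsIn_mono hA _)) (chainsIn_mono hB _)

/-- The map in relative homology induced by an inclusion of pairs. -/
def relHomologyMap {A B A' B' : Set X} (hA : A ⊆ A') (hB : B ⊆ B') (i : ℕ) :
    RelHomology A B i →+ RelHomology A' B' i :=
  QuotientAddGroup.map _ _ (AddSubgroup.inclusion (relCycles_mono hA hB i))
    fun _ hx => relBoundaries_mono hA hB i hx

lemma singularBoundary_mem_relCycles {A B : Set X} (D : Set X) (i : ℕ)
    (x : ↥(relCycles A B (i + 1))) : singularBoundary (i + 1) i x.1 ∈ relCycles B D i := by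
  refine ⟨x.2.2, ?_⟩
  have h : singularBoundary i (i - 1) (singularBoundary (i + 1) i x.1) = 0 :=
    singularBoundary_comp _ _ _ _
  exact (congrArg (· ∈ chainsIn D (i - 1)) h).mpr (zero_mem _)

lemma singularBoundary_mem_relBoundaries {A B : Set X} (D : Set X) (i : ℕ)
    {x : (singularChains X).X (i + 1)} (hx : x ∈ relBoundaries A B (i + 1)) :
    singularBoundary (i + 1) i x ∈ relBoundaries B D i := by
  obtain ⟨y, ⟨w, -, rfl⟩, z, hz, rfl⟩ := AddSubgroup.mem_sup.1 hx
  rw [map_add, singularBoundary_comp, zero_add]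
  exact AddSubgroup.mem_sup_left ⟨z, hz, rfl⟩

/-- The connecting homomorphism `H_{i+1}(A, B) → H_i(B, D)` of the triple `D ⊆ B ⊆ A`,
which sends the class of a relative cycle to the class of its boundary. -/
def relConnecting (A B D : Set X) (i : ℕ) : RelHomology A B (i + 1) →+ RelHomology B D i :=
  QuotientAddGroup.map _ _
    (((singularBoundary (i + 1) i).comp (relCycles A B (i + 1)).subtype).codRestrict
      (relCycles B D i) (singularBoundary_mem_relCycles D i))
    fun _ hx => singularBoundary_mem_relBoundaries D i hx

lemma relConnecting_comp (A B D F : Set X) (i : ℕ) (x : RelHomology A B (i + 2)) :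
    relConnecting B D F i (relConnecting A B D (i + 1) x) = 0 := by
  obtain ⟨x, rfl⟩ := QuotientAddGroup.mk_surjective x
  refine (QuotientAddGroup.eq_zero_iff _).2 ?_
  have h : singularBoundary (i + 1) i (singularBoundary (i + 2) (i + 1) x.1) = 0 :=
    singularBoundary_comp _ _ _ _
  exact (congrArg (· ∈ relBoundaries D F i) h).mpr (zero_mem _)

end SingularChains

section Cellular

variable {X : Type u} [TopologicalSpace X] [T2Space X] (E : Set X) [CWComplex E]

/-- The group of integral cellular chains `H_i(E^i, E^{i-1}; ℤ)`; here
`skeletonLT E (i + 1)` is the `i`-skeleton `E^i`, and `E^{-1} = ∅`. -/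
abbrev CellularChains (i : ℕ) : Type u :=
  RelHomology (skeletonLT E ((i + 1 : ℕ) : ℕ∞) : Set X) (skeletonLT E (i : ℕ∞) : Set X) i

/-- The cellular boundary operator `H_{i+1}(E^{i+1}, E^i) → H_i(E^i, E^{i-1})`. -/
def cellularBoundary (i : ℕ) : CellularChains E (i + 1) →+ CellularChains E i :=
  relConnecting _ _ _ i

/-- A choice of an orientation of every cell of the CW complex `E`. For each `i`-cell `α` it is a
class in `H_i(closed cell, frontier of the cell) ≅ H_i(D^i, S^{i-1}) ≅ ℤ`; the images of these
classes in `H_i(E^i, E^{i-1})` have to form a `ℤ`-basis. As `H_i(E^i, E^{i-1})` is the direct sum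
of the infinite cyclic groups of the `i`-cells, this says precisely that the class of each cell is
one of the two generators. -/
structure CellOrientation where
  orient (i : ℕ) (α : cell E i) : RelHomology (closedCell i α) (cellFrontier i α) i
  basis (i : ℕ) : Module.Basis (cell E i) ℤ (CellularChains E i)
  basis_eq (i : ℕ) (α : cell E i) : basis i α =
    relHomologyMap (CWComplex.closedCell_subset_skeletonLT i α)
      (CWComplex.cellFrontier_subset_skeletonLT i α) i (orient i α)

variable {E}

/-- The incidence number `d_{αβ}` of an `(i+1)`-cell `α` and an `i`-cell `β`: the coefficient of
`β` in the cellular boundary of `α`, which is the degree of the map `S^i → S^i` obtained from the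
attaching map of `α` by collapsing the complement of the cell `β` in `E^i`. -/
def CellOrientation.incidence (o : CellOrientation E) (i : ℕ) (α : cell E (i + 1))
    (β : cell E i) : ℤ :=
  (o.basis i).repr (cellularBoundary E i (o.basis (i + 1) α)) β

/-- Each cell is incident to finitely many cells of the next dimension. -/
def CellOrientation.LocallyFinite (o : CellOrientation E) : Prop :=
  ∀ (i : ℕ) (β : cell E i), {α : cell E (i + 1) | o.incidence i α β ≠ 0}.Finite

end Cellular

/-- The combinatorial data of a CW complex with oriented cells: the cells of each dimension and the
matrices of the cellular boundary operators (with finitely many nonzero entries in each row and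
column, and with `∂ ∘ ∂ = 0`). -/
structure IncidenceData where
  cell : ℕ → Type u
  inc : ∀ i, cell (i + 1) → cell i → ℤ
  finite_faces : ∀ i α, {β | inc i α β ≠ 0}.Finite
  finite_cofaces : ∀ i β, {α | inc i α β ≠ 0}.Finite
  inc_inc : ∀ i α γ, ∑ᶠ β, inc (i + 1) α β * inc i β γ = 0

/-- The incidence data of a CW complex. -/
def CellOrientation.toIncidenceData {X : Type u} [TopologicalSpace X] [T2Space X] {E : Set X} [CWComplex E]
    (o : CellOrientation E) (ho : o.LocallyFinite) : IncidenceData.{u} where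
  cell := Topology.RelCWComplex.cell E
  inc := o.incidence
  finite_faces i α := ((o.basis i).repr (cellularBoundary E i (o.basis (i + 1) α))).hasFiniteSupport
  finite_cofaces := ho
  inc_inc i α γ := by
    have h0 : cellularBoundary E i (cellularBoundary E (i + 1) (o.basis (i + 2) α)) = 0 :=
      relConnecting_comp _ _ _ _ _ _
    have h1 := (o.basis (i + 1)).linearCombination_repr
      (cellularBoundary E (i + 1) (o.basis (i + 2) α))
    have h2 := congrArg (fun x => (o.basis i).repr (cellularBoundary E i x) γ) h1
    simp only [h0, map_zero, Finsupp.coe_zero, Pi.zero_apply] at h2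
    rw [← h2, Finsupp.linearCombination_apply, Finsupp.sum, map_sum, map_sum,
      Finsupp.finsetSum_apply]
    rw [finsum_eq_sum_of_support_subset
      (s := ((o.basis (i + 1)).repr (cellularBoundary E (i + 1) (o.basis (i + 2) α))).support)]
    · refine Finset.sum_congr rfl fun β _ => ?_
      simp [CellOrientation.incidence]
    · intro β hβ
      simp only [Function.mem_support, ne_eq, mul_eq_zero, not_or] at hβ
      exact Finsupp.mem_support_iff.2 hβ.1

section Matrices

variable {A B : Type*} (M : Type*) [AddCommGroup M]

/-- The homomorphism `∑ m_α e_α ↦ ∑_β (∑_α d_{αβ} m_α) e_β` of groups of finite chains defined by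
an integer matrix `d` with finite rows. -/
def matrixMap (d : A → B → ℤ) (hd : ∀ α, {β | d α β ≠ 0}.Finite) : (A →₀ M) →+ (B →₀ M) :=
  Finsupp.liftAddHom fun α =>
    { toFun := fun m => (Finsupp.ofSupportFinite (d α) (hd α)).mapRange (· • m) (zero_smul ℤ m)
      map_zero' := by ext; simp
      map_add' := fun m m' => by ext; simp }

lemma matrixMap_apply (d : A → B → ℤ) (hd : ∀ α, {β | d α β ≠ 0}.Finite) (x : A →₀ M) (β : B) :
    matrixMap M d hd x β = x.sum fun α m => d α β • m := by
  classical
  simp only [matrixMap, Finsupp.liftAddHom_apply, Finsupp.sum, Finsupp.finsetSum_apply]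
  rfl

end Matrices

section Pairing

variable {S : Type*} (G : Type*) [AddCommGroup G]

/-- The dual group `Ĝ = Hom(G, ℚ/ℤ)`. -/
abbrev DualGroup : Type _ := CharacterModule G

variable {G}

@[simp] lemma dual_zero_apply (g : G) : (0 : DualGroup G) g = 0 := rfl

@[simp] lemma dual_add_apply (χ χ' : DualGroup G) (g : G) : (χ + χ') g = χ g + χ' g := rfl

@[simp] lemma dual_neg_apply (χ : DualGroup G) (g : G) : (-χ) g = -χ g := rfl

@[simp] lemma dual_zsmul_apply (k : ℤ) (χ : DualGroup G) (g : G) : (k • χ) g = k • χ g :=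
  map_zsmul ({ toFun := fun χ => χ g, map_zero' := rfl, map_add' := fun _ _ => rfl } :
    DualGroup G →+ AddCircle (1 : ℚ)) k χ

/-- The canonical pairing `⟨∑ χ_α e_α, ∑ g_α e_α⟩ = ∑ χ_α(g_α)` of chains with coefficients in `Ĝ`
and cochains with coefficients in `G` (both with finite support). -/
def pairing : (S →₀ DualGroup G) →+ (S →₀ G) →+ AddCircle (1 : ℚ) :=
  Finsupp.liftAddHom fun α =>
    { toFun := fun χ => (AddMonoidHomClass.toAddMonoidHom χ).comp (Finsupp.applyAddHom α)
      map_zero' := by ext; simp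
      map_add' := fun χ χ' => by ext; simp }

lemma pairing_apply (b : S →₀ DualGroup G) (a : S →₀ G) :
    pairing b a = b.sum fun α χ => χ (a α) := by
  classical
  simp only [pairing, Finsupp.liftAddHom_apply, Finsupp.sum, AddMonoidHom.finsetSum_apply]
  rfl

lemma pairing_single_left (α : S) (χ : DualGroup G) (a : S →₀ G) :
    pairing (Finsupp.single α χ) a = χ (a α) := by
  rw [pairing_apply, Finsupp.sum_single_index (by simp)]

lemma pairing_single_right (α : S) (b : S →₀ DualGroup G) (g : G) :
    pairing b (Finsupp.single α g) = b α g := by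
  classical
  rw [pairing_apply, Finsupp.sum, Finset.sum_eq_single α]
  · simp
  · intro β _ h
    simp [h.symm]
  · intro h
    simp [Finsupp.notMem_support_iff.1 h]

lemma pairing_neg_left (b : S →₀ DualGroup G) (a : S →₀ G) : pairing (-b) a = -pairing b a :=
  congrArg (fun f => f a) (AddMonoidHom.map_neg pairing b)

/-- Transposed matrices are adjoint with respect to the pairing. -/
lemma pairing_matrixMap {A B : Type*} (d : A → B → ℤ) (hd : ∀ α, {β | d α β ≠ 0}.Finite)
    (hd' : ∀ β, {α | d α β ≠ 0}.Finite) (x : A →₀ DualGroup G) (y : B →₀ G) :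
    pairing (matrixMap _ d hd x) y = pairing x (matrixMap _ (fun β α => d α β) hd' y) := by
  induction x using Finsupp.induction_linear with
  | zero => simp
  | add x x' h h' => simp [h, h']
  | single α χ =>
    induction y using Finsupp.induction_linear with
    | zero => simp
    | add y y' h h' => simp only [map_add, h, h']
    | single β g =>
      rw [pairing_single_right, pairing_single_left, matrixMap_apply, matrixMap_apply,
        Finsupp.sum_single_index (by simp), Finsupp.sum_single_index (by simp)]
      simp

end Pairing

namespace IncidenceData

variable (K : IncidenceData.{u}) (n : ℕ)

/-- The cells of dimension `n - 1` (there are none for `n = 0`). -/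
def CellBelow : ℕ → Type u
  | 0 => PEmpty
  | m + 1 => K.cell m

/-- The incidence numbers of the `n`-cells and the `(n-1)`-cells. -/
def incBelow : (n : ℕ) → K.cell n → K.CellBelow n → ℤ
  | 0 => fun _ _ => 0
  | m + 1 => K.inc m

lemma finite_facesBelow (α : K.cell n) : {β | K.incBelow n α β ≠ 0}.Finite := by
  cases n with
  | zero => simp [incBelow]
  | succ m => exact K.finite_faces m α

lemma finite_cofacesBelow (β : K.CellBelow n) : {α | K.incBelow n α β ≠ 0}.Finite := by
  cases n with
  | zero => exact β.elim
  | succ m => exact K.finite_cofaces m β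

lemma inc_incBelow (α : K.cell (n + 1)) (γ : K.CellBelow n) :
    ∑ᶠ β, K.inc n α β * K.incBelow n β γ = 0 := by
  cases n with
  | zero => exact γ.elim
  | succ m => exact K.inc_inc m α γ

variable (G : Type v) [AddCommGroup G]

/-- The boundary operator `∂ : C_{n+1}(E; M) → C_n(E; M)`. -/
def boundary : (K.cell (n + 1) →₀ G) →+ (K.cell n →₀ G) :=
  matrixMap G (K.inc n) (K.finite_faces n)

/-- The boundary operator `∂ : C_n(E; M) → C_{n-1}(E; M)`. -/
def boundaryBelow : (K.cell n →₀ G) →+ (K.CellBelow n →₀ G) :=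
  matrixMap G (K.incBelow n) (K.finite_facesBelow n)

/-- The coboundary operator `∂ᵀ : C^n_lf(E; M) → C^{n+1}_lf(E; M)`. -/
def coboundary : (K.cell n →₀ G) →+ (K.cell (n + 1) →₀ G) :=
  matrixMap G (fun β α => K.inc n α β) (K.finite_cofaces n)

/-- The coboundary operator `∂ᵀ : C^{n-1}_lf(E; M) → C^n_lf(E; M)`. -/
def coboundaryBelow : (K.CellBelow n →₀ G) →+ (K.cell n →₀ G) :=
  matrixMap G (fun β α => K.incBelow n α β) (K.finite_cofacesBelow n)

lemma pairing_boundary (d : K.cell (n + 1) →₀ DualGroup G) (a : K.cell n →₀ G) :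
    pairing (K.boundary n _ d) a = pairing d (K.coboundary n _ a) :=
  pairing_matrixMap _ _ _ _ _

lemma pairing_boundaryBelow (b : K.cell n →₀ DualGroup G) (c : K.CellBelow n →₀ G) :
    pairing (K.boundaryBelow n _ b) c = pairing b (K.coboundaryBelow n _ c) :=
  pairing_matrixMap _ _ _ _ _

lemma boundaryBelow_boundary (x : K.cell (n + 1) →₀ G) :
    K.boundaryBelow n G (K.boundary n G x) = 0 := by
  induction x using Finsupp.induction_linear with
  | zero => simp
  | add x x' h h' => simp [h, h']
  | single α g =>
    ext γ
    simp only [boundary, boundaryBelow, matrixMap_apply, Finsupp.coe_zero, Pi.zero_apply]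
    have h := K.inc_incBelow n α γ
    have hs : ∀ β, matrixMap G (K.inc n) (K.finite_faces n) (Finsupp.single α g) β
        = K.inc n α β • g := fun β => by
      rw [matrixMap_apply, Finsupp.sum_single_index (by simp)]
    rw [Finsupp.sum_of_support_subset (s := (K.finite_faces n α).toFinset), Finset.sum_congr rfl
      (fun β _ => by rw [hs β, smul_smul, mul_comm]), ← Finset.sum_smul,
      ← finsum_eq_sum_of_support_subset, h, zero_smul]
    · intro β hβ
      simp only [Function.mem_support, ne_eq, mul_eq_zero, not_or] at hβ
      simpa using hβ.1
    · intro β hβ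
      have := Finsupp.mem_support_iff.1 hβ
      rw [hs β] at this
      simp only [Set.Finite.mem_toFinset, Set.mem_ofPred_eq]
      intro h0
      simp [h0] at this
    · simp

lemma pairing_boundary_coboundary (d : K.cell (n + 1) →₀ DualGroup G) (c : K.CellBelow n →₀ G) :
    pairing (K.boundary n _ d) (K.coboundaryBelow n _ c) = 0 := by
  rw [← pairing_boundaryBelow, boundaryBelow_boundary]
  simp

/-- The cycles in `C_n(E; M)`. -/
abbrev cycles : AddSubgroup (K.cell n →₀ G) := (K.boundaryBelow n G).ker

/-- The cocycles in `C^n_lf(E; M)`. -/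
abbrev cocycles : AddSubgroup (K.cell n →₀ G) := (K.coboundary n G).ker

/-- The homology group `H_n(E; M)`. -/
abbrev Homology : Type _ :=
  ↥(K.cycles n G) ⧸ (K.boundary n G).range.addSubgroupOf (K.cycles n G)

/-- The locally finite cohomology group `H^n_lf(E; M)`. -/
abbrev LFCohomology : Type _ :=
  ↥(K.cocycles n G) ⧸ (K.coboundaryBelow n G).range.addSubgroupOf (K.cocycles n G)

/-- The pairing of `H_n(E; Ĝ)` and `H^n_lf(E; G)` induced by the pairing of chains and cochains. -/
def homologyPairing :
    K.Homology n (DualGroup G) →+ K.LFCohomology n G →+ AddCircle (1 : ℚ) :=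
  QuotientAddGroup.lift _
    { toFun := fun b => QuotientAddGroup.lift _
        ((pairing b.1).comp (K.cocycles n G).subtype) (by
          rintro ⟨a, ha⟩ ⟨c, hc⟩
          have hc' : K.coboundaryBelow n G c = a := hc
          have hb : K.boundaryBelow n _ b.1 = 0 := b.2
          change pairing b.1 a = 0
          rw [← hc', ← pairing_boundaryBelow, hb]
          simp)
      map_zero' := by
        ext a
        simp
      map_add' := fun b b' => by
        ext a
        simp }
    (by
      rintro ⟨b, hb⟩ ⟨d, hd⟩
      have hd' : K.boundary n _ d = b := hd
      ext a
      have ha : K.coboundary n _ a.1 = 0 := a.2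
      change pairing b a.1 = 0
      rw [← hd', pairing_boundary, ha]
      simp)

lemma homologyPairing_mk (b : K.cycles n (DualGroup G)) (a : K.cocycles n G) :
    K.homologyPairing n G b a = pairing b.1 a.1 := rfl

/-- `c = log₂ |{[b] ∈ H_n | ∀ [a] ∈ H^n_lf, ⟨b, a⟩ = 0}|
  + log₂ |{[a] ∈ H^n_lf | ∀ [b] ∈ H_n, ⟨b, a⟩ = 0}|`. -/
def classicalBits : ℝ :=
  Real.logb 2 (Nat.card {b : K.Homology n (DualGroup G) |
      ∀ a : K.LFCohomology n G, K.homologyPairing n G b a = 0}) +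
    Real.logb 2 (Nat.card {a : K.LFCohomology n G |
      ∀ b : K.Homology n (DualGroup G), K.homologyPairing n G b a = 0})

/-- `q = (log₂ |H_n × H^n_lf| - c) / 2`. -/
def qubits : ℝ :=
  (Real.logb 2 (Nat.card (K.Homology n (DualGroup G) × K.LFCohomology n G)) -
    K.classicalBits n G) / 2

end IncidenceData

section Phase

/-- The character `x ↦ e^{2πix}` of `ℚ/ℤ`. -/
def phaseHom : AddCircle (1 : ℚ) →+ Additive Circle :=
  QuotientAddGroup.lift _
    (Circle.expHom.comp ((AddMonoidHom.mulLeft (2 * Real.pi)).comp (Rat.castHom ℝ).toAddMonoidHom)) (by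
      intro x hx
      obtain ⟨k, rfl⟩ := AddSubgroup.mem_zmultiples_iff.1 hx
      rw [AddMonoidHom.mem_ker, map_zsmul]
      have : (Circle.expHom.comp ((AddMonoidHom.mulLeft (2 * Real.pi)).comp (Rat.castHom ℝ).toAddMonoidHom))
          (1 : ℚ) = 0 := by
        simp
      rw [this, smul_zero])

/-- The number `e^{2πix}` for `x ∈ ℚ/ℤ`. -/
def phase (x : AddCircle (1 : ℚ)) : ℂ := ((phaseHom x).toMul : Circle)

lemma phase_coe (x : ℚ) : phase (x : AddCircle (1 : ℚ)) = Complex.exp (2 * Real.pi * x * Complex.I) := by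
  have h : phase (x : AddCircle (1 : ℚ)) = ((Circle.exp (2 * Real.pi * (x : ℝ)) : Circle) : ℂ) := rfl
  rw [h, Circle.coe_exp]
  push_cast
  rfl

@[simp] lemma phase_zero : phase 0 = 1 := by simp [phase]

lemma phase_add (x y : AddCircle (1 : ℚ)) : phase (x + y) = phase x * phase y := by
  simp [phase]

@[simp] lemma norm_phase (x : AddCircle (1 : ℚ)) : ‖phase x‖ = 1 := Circle.norm_coe _

lemma phase_neg (x : AddCircle (1 : ℚ)) : phase (-x) = star (phase x) := by
  have h : phase (-x) = (((phaseHom x).toMul)⁻¹ : Circle) := by simp [phase]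
  rw [h, Circle.coe_inv_eq_conj]
  rfl

lemma phase_nsmul (m : ℕ) (x : AddCircle (1 : ℚ)) : phase (m • x) = phase x ^ m := by
  simp [phase]

lemma phase_eq_one_iff {x : AddCircle (1 : ℚ)} : phase x = 1 ↔ x = 0 := by
  refine ⟨fun h => ?_, fun h => by simp [h]⟩
  induction x using QuotientAddGroup.induction_on with
  | H q =>
    have h' : phase (q : AddCircle (1 : ℚ)) = 1 := h
    rw [phase_coe, Complex.exp_eq_one_iff] at h'
    obtain ⟨k, hk⟩ := h'
    have h2 : (2 * Real.pi * Complex.I : ℂ) ≠ 0 := Complex.two_pi_I_ne_zero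
    have h3 : (q : ℂ) = k := by
      apply mul_left_cancel₀ h2
      linear_combination hk
    have h4 : q = k := by exact_mod_cast h3
    refine (QuotientAddGroup.eq_zero_iff q).2 ?_
    rw [h4]
    exact AddSubgroup.mem_zmultiples_iff.2 ⟨k, by simp⟩

end Phase

section Observables

variable (S : Type u) (G : Type v) [AddCommGroup G]

/-- The Hilbert space `ℓ²` with orthonormal basis indexed by the configurations `S → G` with finite
support, i.e. the tensor product of copies of `ℓ²(G)` over `S` with respect to the reference
vectors `|0⟩`. -/
abbrev HilbertSpace : Type (max u v) := lp (fun _ : S →₀ G => ℂ) 2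

/-- Bounded operators. -/
abbrev Operators : Type (max u v) := HilbertSpace S G →L[ℂ] HilbertSpace S G

variable {S G}

/-- The configuration that agrees with `τ` on `Λ` and with `σ` elsewhere. -/
def patch (Λ : Finset S) (τ : Λ → G) (σ : S →₀ G) : S →₀ G := by
  classical
  exact Finsupp.onFinset (Λ ∪ σ.support) (fun α => if h : α ∈ Λ then τ ⟨α, h⟩ else σ α) (by
    intro α h
    by_cases hα : α ∈ Λ
    · simp [hα]
    · rw [dif_neg hα] at h
      simp [h])

lemma patch_apply_mem (Λ : Finset S) (τ : Λ → G) (σ : S →₀ G) (α : Λ) :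
    patch Λ τ σ α = τ α := by
  simp [patch]

lemma patch_apply_notMem (Λ : Finset S) (τ : Λ → G) (σ : S →₀ G) {α : S} (h : α ∉ Λ) :
    patch Λ τ σ α = σ α := by
  simp [patch, h]

/-- `T = M ⊗ 1` with `M` an operator on `ℋ_Λ = ℓ²(G^Λ)`, given by its matrix, and `1` the identity
on the sites outside `Λ`. -/
def ActsOn (Λ : Finset S) (M : Matrix (Λ → G) (Λ → G) ℂ) (T : Operators S G) : Prop :=
  ∀ (ψ : HilbertSpace S G) (σ : S →₀ G),
    T ψ σ = ∑ᶠ τ : Λ → G, M (fun α => σ α) τ * ψ (patch Λ τ σ)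

variable (S G)

/-- The local observables: the union of the algebras `𝔄_Λ = B(ℋ_Λ)` over the finite sets `Λ`. -/
def localObservables : Set (Operators S G) :=
  {T | ∃ (Λ : Finset S) (M : Matrix (Λ → G) (Λ → G) ℂ), ActsOn Λ M T}

/-- The quasi-local algebra `𝔄`, the C*-algebra generated by the local observables; it is the direct
limit of the matrix algebras `𝔄_Λ = B(ℋ_Λ)`. -/
def quasiLocal : StarSubalgebra ℂ (Operators S G) :=
  (StarAlgebra.adjoin ℂ (localObservables S G)).topologicalClosure

/-- The quasi-local algebra as a type. -/
abbrev QuasiLocal : Type (max u v) := ↥(quasiLocal S G)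

variable {S G}

lemma norm_circle_mul (z : Circle) (w : ℂ) : ‖(z : ℂ) * w‖ = ‖w‖ := by
  rw [norm_mul, Circle.norm_coe, one_mul]

/-- The unitary `(U ψ)(σ) = θ(σ) ψ(e σ)` for a permutation `e` and phases `θ`. -/
def weightedPerm (θ : (S →₀ G) → Circle) (e : Equiv.Perm (S →₀ G)) : Operators S G :=
  LinearMap.mkContinuous
    { toFun := fun ψ => ⟨fun σ => (θ σ : ℂ) * ψ (e σ), by
        refine memℓp_gen ?_
        have h := (e.summable_iff).2 ((lp.memℓp ψ).summable (by norm_num))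
        exact h.congr fun σ => congrArg (· ^ (2 : ENNReal).toReal) (norm_circle_mul _ _).symm⟩
      map_add' := fun ψ φ => by
        ext σ
        exact mul_add _ _ _
      map_smul' := fun c ψ => by
        ext σ
        exact mul_left_comm _ _ _ } 1 (by
    intro ψ
    rw [one_mul]
    refine le_of_eq ?_
    rw [lp.norm_eq_tsum_rpow (by norm_num), lp.norm_eq_tsum_rpow (by norm_num)]
    congr 1
    rw [← e.tsum_eq (fun σ => ‖ψ σ‖ ^ (2 : ENNReal).toReal)]
    exact tsum_congr fun σ => congrArg (· ^ (2 : ENNReal).toReal) (norm_circle_mul _ _))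

lemma weightedPerm_apply (θ : (S →₀ G) → Circle) (e : Equiv.Perm (S →₀ G))
    (ψ : HilbertSpace S G) (σ : S →₀ G) : weightedPerm θ e ψ σ = (θ σ : ℂ) * ψ (e σ) := rfl

lemma operators_ext {T T' : Operators S G} (h : ∀ ψ σ, T ψ σ = T' ψ σ) : T = T' :=
  ContinuousLinearMap.ext fun ψ => lp.ext (funext (h ψ))

lemma norm_weightedPerm_le (θ : (S →₀ G) → Circle) (e : Equiv.Perm (S →₀ G)) :
    ‖weightedPerm θ e‖ ≤ 1 :=
  LinearMap.mkContinuous_norm_le _ zero_le_one _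

lemma star_weightedPerm (θ : (S →₀ G) → Circle) (e : Equiv.Perm (S →₀ G)) :
    star (weightedPerm θ e) = weightedPerm (fun σ => (θ (e.symm σ))⁻¹) e.symm := by
  rw [ContinuousLinearMap.star_eq_adjoint]
  refine ((ContinuousLinearMap.eq_adjoint_iff _ _).2 fun ψ φ => ?_).symm
  rw [lp.inner_eq_tsum, lp.inner_eq_tsum, ← e.tsum_eq]
  refine tsum_congr fun σ => ?_
  simp only [weightedPerm_apply, Equiv.symm_apply_apply, RCLike.inner_apply]
  rw [Circle.coe_inv_eq_conj]
  simp
  ring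

lemma apply_congr (ψ : HilbertSpace S G) {σ τ : S →₀ G} (h : σ = τ) : ψ σ = ψ τ := h ▸ rfl

/-- The operator `X^a`, with `X^a |σ⟩ = |σ + a⟩`. -/
def opX (a : S →₀ G) : Operators S G := weightedPerm (fun _ => 1) (Equiv.subRight a)

/-- The operator `Z^b`, with `Z^b |σ⟩ = e^{2πi⟨b, σ⟩} |σ⟩`. -/
def opZ (b : S →₀ DualGroup G) : Operators S G :=
  weightedPerm (fun σ => (phaseHom (pairing b σ)).toMul) (Equiv.refl _)

@[simp] lemma opX_apply (a : S →₀ G) (ψ : HilbertSpace S G) (σ : S →₀ G) :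
    opX a ψ σ = ψ (σ - a) := by
  simp [opX, weightedPerm_apply]

@[simp] lemma opZ_apply (b : S →₀ DualGroup G) (ψ : HilbertSpace S G) (σ : S →₀ G) :
    opZ b ψ σ = phase (pairing b σ) * ψ σ := rfl

lemma opX_add (a a' : S →₀ G) : opX (a + a') = opX a * opX a' :=
  operators_ext fun ψ σ => by
    simp [sub_sub]

lemma opZ_add (b b' : S →₀ DualGroup G) : opZ (b + b') = opZ b * opZ b' :=
  operators_ext fun ψ σ => by
    simp [phase_add, mul_assoc]

@[simp] lemma opX_zero : opX (0 : S →₀ G) = 1 := operators_ext fun ψ σ => by simp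

@[simp] lemma opZ_zero : opZ (0 : S →₀ DualGroup G) = 1 := operators_ext fun ψ σ => by simp

lemma opZ_mul_opX (a : S →₀ G) (b : S →₀ DualGroup G) :
    opZ b * opX a = phase (pairing b a) • (opX a * opZ b) :=
  operators_ext fun ψ σ => by
    have : phase (pairing b σ) = phase (pairing b a) * phase (pairing b (σ - a)) := by
      rw [← phase_add, ← map_add, add_sub_cancel]
    simp [this, mul_assoc]

lemma star_opX (a : S →₀ G) : star (opX a) = opX (-a) := by
  rw [opX, star_weightedPerm]
  exact operators_ext fun ψ σ => by simp [weightedPerm_apply]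

lemma star_opZ (b : S →₀ DualGroup G) : star (opZ b) = opZ (-b) := by
  rw [opZ, star_weightedPerm]
  exact operators_ext fun ψ σ => by
    have h : ((((phaseHom (pairing b σ)).toMul)⁻¹ : Circle) : ℂ) = phase (pairing (-b) σ) := by
      rw [pairing_neg_left, phase_neg, phase, Circle.coe_inv_eq_conj]
      rfl
    exact congrArg (· * ψ σ) h

lemma opX_mem_local (a : S →₀ G) : opX a ∈ localObservables S G := by
  classical
  refine ⟨a.support, fun s t => if t = fun α => s α - a α then 1 else 0, fun ψ σ => ?_⟩
  have e : σ - a = patch a.support (fun α : a.support => σ α - a α) σ := by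
    ext α
    by_cases h : α ∈ a.support
    · exact (patch_apply_mem a.support (fun α : a.support => σ α - a α) σ ⟨α, h⟩).symm
    · rw [patch_apply_notMem _ _ _ h]
      simp [Finsupp.notMem_support_iff.1 h]
  rw [finsum_eq_single _ (fun α : a.support => σ α - a α)]
  · beta_reduce
    rw [if_pos rfl, one_mul, opX_apply]
    exact apply_congr ψ e
  · intro τ h
    simp [h]

lemma opZ_mem_local (b : S →₀ DualGroup G) : opZ b ∈ localObservables S G := by
  classical
  refine ⟨b.support, fun s t => if t = s then phase (∑ α : b.support, b α (s α)) else 0,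
    fun ψ σ => ?_⟩
  have e : σ = patch b.support (fun α : b.support => σ α) σ := by
    ext α
    by_cases h : α ∈ b.support
    · exact (patch_apply_mem b.support (fun α : b.support => σ α) σ ⟨α, h⟩).symm
    · rw [patch_apply_notMem _ _ _ h]
  rw [finsum_eq_single _ (fun α : b.support => σ α)]
  · beta_reduce
    rw [if_pos rfl, opZ_apply, pairing_apply, Finsupp.sum, ← Finset.sum_coe_sort]
    exact congrArg (phase _ * ·) (apply_congr ψ e)
  · intro τ h
    simp [h]

/-- `X^a` as a quasi-local observable. -/
def obsX (a : S →₀ G) : QuasiLocal S G :=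
  ⟨opX a, StarSubalgebra.le_topologicalClosure _
    (StarAlgebra.subset_adjoin ℂ _ (opX_mem_local a))⟩

/-- `Z^b` as a quasi-local observable. -/
def obsZ (b : S →₀ DualGroup G) : QuasiLocal S G :=
  ⟨opZ b, StarSubalgebra.le_topologicalClosure _
    (StarAlgebra.subset_adjoin ℂ _ (opZ_mem_local b))⟩

end Observables

section Density

variable {S : Type u} {G : Type v} [AddCommGroup G]

lemma exists_dual_ne_zero {g : G} (hg : g ≠ 0) : ∃ χ : DualGroup G, χ g ≠ 0 :=
  CharacterModule.exists_character_apply_ne_zero_of_ne_zero hg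

lemma phaseHom_injective : Function.Injective phaseHom := by
  refine (injective_iff_map_eq_zero _).2 fun x hx => ?_
  refine phase_eq_one_iff.1 ?_
  rw [phase, hx]
  rfl

instance dualGroup_finite [Finite G] : Finite (DualGroup G) := by
  let f : DualGroup G → AddChar G Circle := fun χ =>
    { toFun := fun g => (phaseHom (χ g)).toMul
      map_zero_eq_one' := by simp
      map_add_eq_mul' := fun g h => by simp }
  let g : AddChar G Circle → AddChar G ℂ := fun χ => Circle.coeHom.compAddChar χ
  have hg : Function.Injective g := fun χ χ' h => by
    ext x
    exact congrArg (fun f => f x) h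
  refine Finite.of_injective (fun χ => g (f χ)) fun χ χ' h => ?_
  ext x
  have h1 : f χ x = f χ' x := congrArg (fun f => f x) (hg h)
  exact phaseHom_injective h1

lemma sum_op_apply {ι : Type*} (s : Finset ι) (f : ι → Operators S G) (ψ : HilbertSpace S G)
    (σ : S →₀ G) : (∑ i ∈ s, f i) ψ σ = ∑ i ∈ s, f i ψ σ := by
  classical
  induction s using Finset.induction_on with
  | empty => simp
  | insert i s hi ih =>
    rw [Finset.sum_insert hi, Finset.sum_insert hi, ← ih]
    rfl

variable (S G)

/-- The linear span of the operators `X^a Z^b`. -/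
def pauliSpan : Submodule ℂ (Operators S G) :=
  Submodule.span ℂ {T | ∃ a b, T = opX a * opZ b}

variable {S G}

lemma pauli_mul (a a' : S →₀ G) (b b' : S →₀ DualGroup G) :
    (opX a * opZ b) * (opX a' * opZ b') =
      phase (pairing b a') • (opX (a + a') * opZ (b + b')) := by
  rw [mul_assoc, ← mul_assoc (opZ b), opZ_mul_opX, smul_mul_assoc, mul_smul_comm, opX_add, opZ_add]
  simp only [mul_assoc]

lemma star_pauli (a : S →₀ G) (b : S →₀ DualGroup G) :
    star (opX a * opZ b) = phase (pairing b a) • (opX (-a) * opZ (-b)) := by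
  rw [star_mul, star_opX, star_opZ, opZ_mul_opX, pairing_neg_left, map_neg, neg_neg]

lemma opZ_mem_pauliSpan (b : S →₀ DualGroup G) : opZ b ∈ pauliSpan S G :=
  Submodule.subset_span ⟨0, b, by simp⟩

lemma opX_mul_mem_pauliSpan (a : S →₀ G) {T : Operators S G}
    (hT : T ∈ Submodule.span ℂ (Set.range (opZ : (S →₀ DualGroup G) → Operators S G))) :
    opX a * T ∈ pauliSpan S G := by
  induction hT using Submodule.span_induction with
  | mem x hx =>
    obtain ⟨b, rfl⟩ := hx
    exact Submodule.subset_span ⟨a, b, rfl⟩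
  | zero => simp
  | add x y _ _ hx hy => rw [mul_add]; exact add_mem hx hy
  | smul c x _ hx => rw [mul_smul_comm]; exact Submodule.smul_mem _ _ hx

/-- Extension by zero. -/
def extendZero {M : Type*} [AddCommGroup M] (Λ : Finset S) (u : Λ → M) : S →₀ M := by
  classical
  exact Finsupp.onFinset Λ (fun α => if h : α ∈ Λ then u ⟨α, h⟩ else 0) (by
    intro α h
    by_contra hα
    simp [hα] at h)

lemma extendZero_apply_mem {M : Type*} [AddCommGroup M] (Λ : Finset S) (u : Λ → M) (α : Λ) :
    extendZero Λ u α = u α := by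
  simp [extendZero]

lemma extendZero_apply_notMem {M : Type*} [AddCommGroup M] (Λ : Finset S) (u : Λ → M) {α : S}
    (h : α ∉ Λ) : extendZero Λ u α = 0 := by
  simp [extendZero, h]

lemma pairing_extendZero (Λ : Finset S) (χ : Λ → DualGroup G) (σ : S →₀ G) :
    pairing (extendZero Λ χ) σ = ∑ α : Λ, χ α (σ α) := by
  classical
  rw [pairing_apply, Finsupp.sum_of_support_subset (s := Λ), ← Finset.sum_coe_sort]
  · refine Finset.sum_congr rfl fun α _ => ?_
    rw [extendZero_apply_mem]
  · intro α h
    by_contra hα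
    exact Finsupp.mem_support_iff.1 h (extendZero_apply_notMem Λ χ hα)
  · simp

lemma sum_phase_eq_zero {Λ : Type*} [Fintype Λ] [Fintype (Λ → DualGroup G)] {t : Λ → G}
    (ht : t ≠ 0) : ∑ χ : Λ → DualGroup G, phase (∑ α, χ α (t α)) = 0 := by
  classical
  obtain ⟨α, hα⟩ := Function.ne_iff.1 ht
  obtain ⟨χ₀, h₀⟩ := exists_dual_ne_zero hα
  have h1 : ∑ χ : Λ → DualGroup G, phase (∑ α, χ α (t α)) =
      phase (χ₀ (t α)) * ∑ χ : Λ → DualGroup G, phase (∑ α, χ α (t α)) := by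
    rw [Finset.mul_sum, ← Equiv.sum_comp (Equiv.addRight (Pi.single α χ₀))]
    refine Finset.sum_congr rfl fun χ _ => ?_
    rw [← phase_add]
    congr 1
    simp only [Equiv.coe_addRight, Pi.add_apply, dual_add_apply, Finset.sum_add_distrib]
    rw [add_comm]
    congr 1
    rw [Finset.sum_eq_single α]
    · simp
    · intro β _ h
      simp [h]
    · simp
  have h2 : phase (χ₀ (t α)) ≠ 1 := fun h => h₀ (phase_eq_one_iff.1 h)
  have h3 : (phase (χ₀ (t α)) - 1) * ∑ χ : Λ → DualGroup G, phase (∑ α, χ α (t α)) = 0 := by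
    rw [sub_mul, one_mul, ← h1, sub_self]
  exact (mul_eq_zero.1 h3).resolve_left (sub_ne_zero.2 h2)

/-- The projection onto the configurations that agree with `t` on `Λ` is a linear combination of
the operators `Z^b`. -/
lemma exists_projection [Finite G] (Λ : Finset S) (t : Λ → G) :
    ∃ D ∈ Submodule.span ℂ (Set.range (opZ : (S →₀ DualGroup G) → Operators S G)),
      (∀ (ψ : HilbertSpace S G) (σ : S →₀ G), (fun α : Λ => σ α) = t → D ψ σ = ψ σ) ∧
      (∀ (ψ : HilbertSpace S G) (σ : S →₀ G), (fun α : Λ => σ α) ≠ t → D ψ σ = 0) := by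
  classical
  let _ : Fintype (Λ → DualGroup G) := Fintype.ofFinite _
  have key : ∀ (ψ : HilbertSpace S G) (σ : S →₀ G),
      (∑ χ : Λ → DualGroup G, ((Fintype.card (Λ → DualGroup G) : ℂ)⁻¹ *
        phase (-∑ α, χ α (t α))) • opZ (extendZero Λ χ)) ψ σ =
      (Fintype.card (Λ → DualGroup G) : ℂ)⁻¹ *
        (∑ χ : Λ → DualGroup G, phase (∑ α, χ α (σ α - t α))) * ψ σ := by
    intro ψ σ
    have h1 : ∀ χ : Λ → DualGroup G, (((Fintype.card (Λ → DualGroup G) : ℂ)⁻¹ *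
        phase (-∑ α, χ α (t α))) • opZ (extendZero Λ χ)) ψ σ =
        (Fintype.card (Λ → DualGroup G) : ℂ)⁻¹ * phase (∑ α, χ α (σ α - t α)) * ψ σ := by
      intro χ
      have h2 : phase (∑ α, χ α (σ α - t α)) =
          phase (-∑ α, χ α (t α)) * phase (pairing (extendZero Λ χ) σ) := by
        rw [← phase_add, pairing_extendZero]
        congr 1
        simp only [map_sub, Finset.sum_sub_distrib]
        abel
      rw [h2]
      change ((Fintype.card (Λ → DualGroup G) : ℂ)⁻¹ * phase (-∑ α, χ α (t α))) *
        (phase (pairing (extendZero Λ χ) σ) * ψ σ) = _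
      ring
    rw [sum_op_apply, Finset.sum_congr rfl fun χ _ => h1 χ, ← Finset.sum_mul, ← Finset.mul_sum]
  refine ⟨∑ χ : Λ → DualGroup G, ((Fintype.card (Λ → DualGroup G) : ℂ)⁻¹ *
        phase (-∑ α, χ α (t α))) • opZ (extendZero Λ χ),
    Submodule.sum_mem _ fun χ _ => Submodule.smul_mem _ _
    (Submodule.subset_span ⟨extendZero Λ χ, rfl⟩), fun ψ σ h => ?_, fun ψ σ h => ?_⟩
  · refine (key ψ σ).trans ?_
    have h3 : ∀ χ : Λ → DualGroup G, phase (∑ α, χ α (σ α - t α)) = 1 := by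
      intro χ
      have : ∀ α : Λ, χ α (σ α - t α) = 0 := fun α => by
        rw [← h]
        simp
      simp [this]
    simp only [h3]
    have : (Fintype.card (Λ → DualGroup G) : ℂ) ≠ 0 := by
      exact_mod_cast Fintype.card_ne_zero
    simp [this]
  · refine (key ψ σ).trans ?_
    have h4 : (fun α : Λ => σ α - t α) ≠ 0 := fun h0 => h (by
      ext α
      exact sub_eq_zero.1 (congrFun h0 α))
    rw [sum_phase_eq_zero h4]
    simp

lemma local_mem_pauliSpan [Finite G] {T : Operators S G} (hT : T ∈ localObservables S G) :
    T ∈ pauliSpan S G := by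
  classical
  obtain ⟨Λ, M, hM⟩ := hT
  let _ : Fintype (Λ → G) := Fintype.ofFinite _
  choose D hD hD1 hD0 using exists_projection (S := S) (G := G) Λ
  have : T = ∑ s : Λ → G, ∑ t : Λ → G, M s t • (opX (extendZero Λ (s - t)) * D t) := by
    refine operators_ext fun ψ σ => ?_
    rw [hM ψ σ, finsum_eq_sum_of_fintype, sum_op_apply]
    refine Eq.symm ((Finset.sum_eq_single (fun α : Λ => σ α) ?_ ?_).trans ?_)
    · intro s _ hs
      rw [sum_op_apply]
      refine Finset.sum_eq_zero fun t _ => ?_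
      change M s t * (opX (extendZero Λ (s - t)) (D t ψ)) σ = 0
      rw [opX_apply, hD0, mul_zero]
      intro h
      apply hs
      ext α
      have := congrFun h α
      simp only [Finsupp.sub_apply, extendZero_apply_mem, Pi.sub_apply] at this
      rw [sub_eq_iff_eq_add] at this
      rw [this]
      abel
    · simp
    · rw [sum_op_apply]
      refine Finset.sum_congr rfl fun t _ => ?_
      change M (fun α : Λ => σ α) t * (opX (extendZero Λ ((fun α : Λ => σ α) - t)) (D t ψ)) σ = _
      rw [opX_apply, hD1]
      · refine congrArg (M (fun α : Λ => σ α) t * ·) (apply_congr ψ (Finsupp.ext fun α => ?_))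
        by_cases h : α ∈ Λ
        · rw [patch_apply_mem Λ t σ ⟨α, h⟩, Finsupp.sub_apply,
            extendZero_apply_mem Λ _ ⟨α, h⟩]
          simp
        · rw [patch_apply_notMem _ _ _ h, Finsupp.sub_apply, extendZero_apply_notMem Λ _ h,
            sub_zero]
      · ext α
        rw [Finsupp.sub_apply, extendZero_apply_mem]
        simp
  rw [this]
  exact Submodule.sum_mem _ fun s _ => Submodule.sum_mem _ fun t _ =>
    Submodule.smul_mem _ _ (opX_mul_mem_pauliSpan _ (hD t))

lemma quasiLocal_le_closure_pauliSpan [Finite G] {T : Operators S G} (hT : T ∈ quasiLocal S G) :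
    T ∈ closure (pauliSpan S G : Set (Operators S G)) := by
  have h : (StarAlgebra.adjoin ℂ (localObservables S G) : Set (Operators S G)) ⊆
      pauliSpan S G := by
    intro x hx
    induction hx using StarAlgebra.adjoin_induction with
    | mem x hx => exact local_mem_pauliSpan hx
    | algebraMap r =>
      rw [Algebra.algebraMap_eq_smul_one]
      exact Submodule.smul_mem _ _ (Submodule.subset_span ⟨0, 0, by simp⟩)
    | add x y _ _ hx hy => exact add_mem hx hy
    | mul x y _ _ hx hy =>
      have : x * y ∈ pauliSpan S G * pauliSpan S G := Submodule.mul_mem_mul hx hy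
      rw [pauliSpan, Submodule.span_mul_span] at this
      refine Submodule.span_le.2 ?_ this
      rintro _ ⟨_, ⟨a, b, rfl⟩, _, ⟨a', b', rfl⟩, rfl⟩
      change _ ∈ pauliSpan S G
      beta_reduce
      rw [pauli_mul]
      exact Submodule.smul_mem _ _ (Submodule.subset_span ⟨_, _, rfl⟩)
    | star x hx' hx =>
      clear hx'
      change x ∈ pauliSpan S G at hx
      change star x ∈ pauliSpan S G
      induction hx using Submodule.span_induction with
      | mem x hx =>
        obtain ⟨a, b, rfl⟩ := hx
        rw [star_pauli]
        exact Submodule.smul_mem _ _ (Submodule.subset_span ⟨_, _, rfl⟩)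
      | zero => simp
      | add x y _ _ hx hy => rw [star_add]; exact add_mem hx hy
      | smul c x _ hx => rw [star_smul]; exact Submodule.smul_mem _ _ hx
  exact closure_mono h hT

/-- Averaging over the conjugations with the powers of `X^p Z^q`. -/
lemma exists_average [Finite G] (p : S →₀ G) (q : S →₀ DualGroup G) :
    ∃ P : Operators S G →ₗ[ℂ] Operators S G, (∀ T, ‖P T‖ ≤ ‖T‖) ∧
      (∀ T, T * opX p = opX p * T → T * opZ q = opZ q * T → P T = T) ∧
      (∀ a b, pairing q a = pairing b p → P (opX a * opZ b) = opX a * opZ b) ∧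
      (∀ a b, pairing q a ≠ pairing b p → P (opX a * opZ b) = 0) := by
  classical
  let m := Nat.card G
  have hm : (m : ℂ) ≠ 0 := by
    have : m ≠ 0 := Nat.card_pos.ne'
    exact_mod_cast this
  let V : ℕ → Operators S G := fun j => opX (j • p) * opZ (j • q)
  let V' : ℕ → Operators S G := fun j => opZ (-(j • q)) * opX (-(j • p))
  have hVV' : ∀ j, V j * V' j = 1 := fun j => by
    simp only [V, V']
    rw [mul_assoc, ← mul_assoc (opZ _), ← opZ_add, add_neg_cancel, opZ_zero, one_mul, ← opX_add,
      add_neg_cancel, opX_zero]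
  have hV : ∀ j, ‖V j‖ ≤ 1 := fun j =>
    (norm_mul_le _ _).trans (mul_le_one₀ (norm_weightedPerm_le _ _) (norm_nonneg _)
      (norm_weightedPerm_le _ _))
  have hV' : ∀ j, ‖V' j‖ ≤ 1 := fun j =>
    (norm_mul_le _ _).trans (mul_le_one₀ (norm_weightedPerm_le _ _) (norm_nonneg _)
      (norm_weightedPerm_le _ _))
  let P : Operators S G →ₗ[ℂ] Operators S G :=
    (m : ℂ)⁻¹ • ∑ j ∈ Finset.range m, LinearMap.mulLeft ℂ (V j) ∘ₗ LinearMap.mulRight ℂ (V' j)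
  have hP : ∀ T, P T = (m : ℂ)⁻¹ • ∑ j ∈ Finset.range m, V j * (T * V' j) := fun T => by
    simp [P, LinearMap.sum_apply]
  have hconst : ∀ T, (∀ j, V j * (T * V' j) = T) → P T = T := fun T h => by
    rw [hP, Finset.sum_congr rfl fun j _ => h j, Finset.sum_const, Finset.card_range,
      ← Nat.cast_smul_eq_nsmul ℂ, smul_smul, inv_mul_cancel₀ hm, one_smul]
  have hconj : ∀ a b j, V j * (opX a * opZ b * V' j) =
      phase (pairing q a - pairing b p) ^ j • (opX a * opZ b) := by
    intro a b j
    have h1 : opX a * opZ b * V j = phase (pairing b (j • p) - pairing (j • q) a) •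
        (V j * (opX a * opZ b)) := by
      simp only [V]
      rw [pauli_mul, pauli_mul, smul_smul, ← phase_add, sub_add_cancel, add_comm a, add_comm b]
    have h2 : V j * (opX a * opZ b) = phase (pairing q a - pairing b p) ^ j •
        (opX a * opZ b * V j) := by
      rw [h1, smul_smul, ← phase_nsmul, ← phase_add]
      have h3 : j • (pairing q a - pairing b p) + (pairing b (j • p) - pairing (j • q) a) = 0 := by
        have h4 : pairing (j • q) a = j • pairing q a :=
          congrArg (fun f => f a) (AddMonoidHom.map_nsmul pairing j q)
        rw [h4, map_nsmul, nsmul_sub]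
        abel
      rw [h3, phase_zero, one_smul]
    rw [← mul_assoc, h2, smul_mul_assoc, mul_assoc, hVV', mul_one]
  refine ⟨P, fun T => ?_, fun T hX hZ => hconst T fun j => ?_, fun a b h => hconst _ fun j => ?_,
    fun a b h => ?_⟩
  · rw [hP, norm_smul, norm_inv, Complex.norm_natCast]
    have hm' : (0 : ℝ) < m := by exact_mod_cast Nat.card_pos (α := G)
    rw [inv_mul_le_iff₀ hm']
    calc ‖∑ j ∈ Finset.range m, V j * (T * V' j)‖
        ≤ ∑ j ∈ Finset.range m, ‖T‖ := norm_sum_le_of_le _ fun j _ => by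
          calc ‖V j * (T * V' j)‖ ≤ ‖V j‖ * (‖T‖ * ‖V' j‖) :=
                (norm_mul_le _ _).trans (by gcongr; exact norm_mul_le _ _)
            _ ≤ 1 * (‖T‖ * 1) := by
                gcongr
                · exact hV j
                · exact hV' j
            _ = ‖T‖ := by ring
      _ = m * ‖T‖ := by simp
  · have hXj : ∀ j : ℕ, T * opX (j • p) = opX (j • p) * T := fun j => by
      induction j with
      | zero => simp
      | succ j ih => rw [succ_nsmul, opX_add, ← mul_assoc, ih, mul_assoc, hX, mul_assoc]
    have hZj : ∀ j : ℕ, T * opZ (j • q) = opZ (j • q) * T := fun j => by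
      induction j with
      | zero => simp
      | succ j ih => rw [succ_nsmul, opZ_add, ← mul_assoc, ih, mul_assoc, hZ, mul_assoc]
    have hT : T * V j = V j * T := by
      simp only [V]
      rw [← mul_assoc, hXj, mul_assoc, hZj, mul_assoc]
    rw [← mul_assoc, ← hT, mul_assoc, hVV', mul_one]
  · rw [hconj, h, sub_self, phase_zero, one_pow, one_smul]
  · rw [hP, Finset.sum_congr rfl fun j _ => hconj a b j, ← Finset.sum_smul]
    have hz : phase (pairing q a - pairing b p) ≠ 1 := fun h0 =>
      h (sub_eq_zero.1 (phase_eq_one_iff.1 h0))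
    have hzm : phase (pairing q a - pairing b p) ^ m = 1 := by
      rw [← phase_nsmul]
      have h1 : m • pairing q a = 0 := by
        rw [← map_nsmul]
        have : m • a = 0 := by
          ext α
          simp [m]
        rw [this, map_zero]
      have h2 : m • pairing b p = 0 := by
        rw [← map_nsmul]
        have : m • p = 0 := by
          ext α
          simp [m]
        rw [this, map_zero]
      rw [nsmul_sub, h1, h2, sub_zero, phase_zero]
    rw [geom_sum_eq hz, hzm, sub_self, zero_div, zero_smul, smul_zero]

end Density

namespace IncidenceData

variable (K : IncidenceData.{u}) (n : ℕ) (G : Type v) [AddCommGroup G]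

/-- The unitaries `X^{∂ᵀc} Z^{∂d}` with `c ∈ C^{n-1}_lf(E; G)` and `d ∈ C_{n+1}(E; Ĝ)`. -/
def stabilizers : Set (QuasiLocal (K.cell n) G) :=
  {T | ∃ (c : K.CellBelow n →₀ G) (d : K.cell (n + 1) →₀ DualGroup G),
    T = obsX (K.coboundaryBelow n G c) * obsZ (K.boundary n _ d)}

/-- The commutative C*-algebra `𝔄_XZ`, the closed linear span of the unitaries `X^{∂ᵀc} Z^{∂d}`. -/
def stabilizerAlgebra : Submodule ℂ (QuasiLocal (K.cell n) G) :=
  (Submodule.span ℂ (K.stabilizers n G)).topologicalClosure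

/-- The commutant `𝔄_XZ'` of `𝔄_XZ` in the quasi-local algebra. -/
def commutant : StarSubalgebra ℂ (QuasiLocal (K.cell n) G) :=
  StarSubalgebra.centralizer ℂ (K.stabilizerAlgebra n G : Set (QuasiLocal (K.cell n) G))

/-- The elements `X^a Z^b - X^{a+∂ᵀc} Z^{b+∂d}` of `𝔄_XZ'`, with `∂ᵀa = 0` and `∂b = 0`. -/
def logicalRelations : Set ↥(K.commutant n G) :=
  {T | ∃ a ∈ K.cocycles n G, ∃ b ∈ K.cycles n (DualGroup G),
    ∃ (c : K.CellBelow n →₀ G) (d : K.cell (n + 1) →₀ DualGroup G),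
    (T : QuasiLocal (K.cell n) G) = obsX a * obsZ b -
      obsX (a + K.coboundaryBelow n G c) * obsZ (b + K.boundary n _ d)}

/-- `J`, the closed linear span of the elements `X^a Z^b - X^{a+∂ᵀc} Z^{b+∂d}`. -/
def logicalSubspace : Submodule ℂ ↥(K.commutant n G) :=
  (Submodule.span ℂ (K.logicalRelations n G)).topologicalClosure

variable {K n G}

lemma exists_detect {a : K.cell n →₀ G} {b : K.cell n →₀ DualGroup G}
    (h : ¬(a ∈ K.cocycles n G ∧ b ∈ K.cycles n (DualGroup G))) :
    ∃ c d, pairing (K.boundary n _ d) a ≠ pairing b (K.coboundaryBelow n G c) := by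
  by_cases ha : a ∈ K.cocycles n G
  · have hb : K.boundaryBelow n _ b ≠ 0 := fun hb => h ⟨ha, hb⟩
    obtain ⟨γ, hγ⟩ := Finsupp.ne_iff.1 hb
    obtain ⟨g, hg⟩ : ∃ g, K.boundaryBelow n _ b γ g ≠ 0 := by
      by_contra! h0
      exact hγ (CharacterModule.ext _ h0)
    refine ⟨Finsupp.single γ g, 0, ?_⟩
    rw [← pairing_boundaryBelow, pairing_single_right]
    simpa using hg.symm
  · have ha' : K.coboundary n G a ≠ 0 := ha
    obtain ⟨β, hβ⟩ := Finsupp.ne_iff.1 ha'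
    obtain ⟨χ, hχ⟩ := exists_dual_ne_zero hβ
    refine ⟨0, Finsupp.single β χ, ?_⟩
    rw [pairing_boundary, pairing_single_left]
    simpa using hχ

variable (K n G) in
/-- The operators `X^a Z^b` with `∂ᵀa = 0` and `∂b = 0`. -/
def cyclePaulis : Set (Operators (K.cell n) G) :=
  {T | ∃ a ∈ K.cocycles n G, ∃ b ∈ K.cycles n (DualGroup G), T = opX a * opZ b}

lemma exists_cycle_approx_aux [Finite G] {T : Operators (K.cell n) G}
    (hX : ∀ c, T * opX (K.coboundaryBelow n G c) = opX (K.coboundaryBelow n G c) * T)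
    (hZ : ∀ d, T * opZ (K.boundary n _ d) = opZ (K.boundary n _ d) * T)
    (F : Finset (Operators (K.cell n) G)) (hF : ∀ x ∈ F, ∃ a b, x = opX a * opZ b) :
    ∀ T₀ ∈ Submodule.span ℂ (↑F ∪ K.cyclePaulis n G),
      ∃ T₁ ∈ Submodule.span ℂ (K.cyclePaulis n G), ‖T - T₁‖ ≤ ‖T - T₀‖ := by
  classical
  induction F using Finset.induction_on with
  | empty =>
    intro T₀ h
    exact ⟨T₀, by simpa using h, le_rfl⟩
  | insert x F _ ih =>
    intro T₀ h
    have ih' := ih fun y hy => hF y (Finset.mem_insert_of_mem hy)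
    obtain ⟨a, b, rfl⟩ := hF x (Finset.mem_insert_self x F)
    by_cases hab : a ∈ K.cocycles n G ∧ b ∈ K.cycles n (DualGroup G)
    · refine ih' T₀ (Submodule.span_mono ?_ h)
      intro y hy
      rcases hy with hy | hy
      · rcases Finset.mem_insert.1 hy with rfl | hy
        · exact Or.inr ⟨a, hab.1, b, hab.2, rfl⟩
        · exact Or.inl hy
      · exact Or.inr hy
    · obtain ⟨c, d, hcd⟩ := exists_detect hab
      obtain ⟨P, hP, hPT, hP1, hP0⟩ :=
        exists_average (K.coboundaryBelow n G c) (K.boundary n _ d)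
      have hmem : P T₀ ∈ Submodule.span ℂ (↑F ∪ K.cyclePaulis n G) := by
        have h1 : Submodule.span ℂ (↑(insert (opX a * opZ b) F) ∪ K.cyclePaulis n G) ≤
            (Submodule.span ℂ (↑F ∪ K.cyclePaulis n G)).comap P := by
          refine Submodule.span_le.2 fun y hy => ?_
          have h2 : ∀ y ∈ (↑F ∪ K.cyclePaulis n G : Set (Operators (K.cell n) G)),
              (∃ a b, y = opX a * opZ b) → P y ∈ Submodule.span ℂ (↑F ∪ K.cyclePaulis n G) := by
            rintro _ hy ⟨a', b', rfl⟩
            by_cases h3 : pairing (K.boundary n _ d) a' = pairing b' (K.coboundaryBelow n G c)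
            · rw [hP1 _ _ h3]
              exact Submodule.subset_span hy
            · rw [hP0 _ _ h3]
              exact zero_mem _
          rcases hy with hy | hy
          · rcases Finset.mem_insert.1 hy with rfl | hy
            · change P (opX a * opZ b) ∈ Submodule.span ℂ (↑F ∪ K.cyclePaulis n G)
              rw [hP0 _ _ hcd]
              exact zero_mem _
            · exact h2 y (Or.inl hy) (hF y (Finset.mem_insert_of_mem hy))
          · obtain ⟨a', _, b', _, h3⟩ := id hy
            exact h2 y (Or.inr hy) ⟨a', b', h3⟩
        exact h1 h
      obtain ⟨T₁, hT₁, hle⟩ := ih' _ hmem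
      refine ⟨T₁, hT₁, hle.trans ?_⟩
      calc ‖T - P T₀‖ = ‖P (T - T₀)‖ := by rw [map_sub, hPT T (hX c) (hZ d)]
        _ ≤ ‖T - T₀‖ := hP _

lemma exists_cycle_approx [Finite G] {T : Operators (K.cell n) G}
    (hT : T ∈ quasiLocal (K.cell n) G)
    (hX : ∀ c, T * opX (K.coboundaryBelow n G c) = opX (K.coboundaryBelow n G c) * T)
    (hZ : ∀ d, T * opZ (K.boundary n _ d) = opZ (K.boundary n _ d) * T) {ε : ℝ} (hε : 0 < ε) :
    ∃ T₁ ∈ Submodule.span ℂ (K.cyclePaulis n G), ‖T - T₁‖ < ε := by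
  obtain ⟨T₀, hT₀, hd⟩ := Metric.mem_closure_iff.1 (quasiLocal_le_closure_pauliSpan hT) ε hε
  obtain ⟨F, hF, hTF⟩ := Submodule.mem_span_finite_of_mem_span hT₀
  obtain ⟨T₁, h1, h2⟩ := exists_cycle_approx_aux hX hZ F (fun x hx => hF hx) T₀
    (Submodule.span_mono Set.subset_union_left hTF)
  exact ⟨T₁, h1, h2.trans_lt (by rwa [dist_eq_norm] at hd)⟩

lemma obsX_add (a a' : K.cell n →₀ G) : obsX (a + a') = obsX a * obsX a' :=
  Subtype.ext (opX_add a a')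

lemma obsZ_add (b b' : K.cell n →₀ DualGroup G) : obsZ (b + b') = obsZ b * obsZ b' :=
  Subtype.ext (opZ_add b b')

lemma obsZ_mul_obsX (a : K.cell n →₀ G) (b : K.cell n →₀ DualGroup G) :
    obsZ b * obsX a = phase (pairing b a) • (obsX a * obsZ b) :=
  Subtype.ext (opZ_mul_opX a b)

lemma obsX_zero : obsX (0 : K.cell n →₀ G) = 1 := Subtype.ext opX_zero

lemma obsZ_zero : obsZ (0 : K.cell n →₀ DualGroup G) = 1 := Subtype.ext opZ_zero

lemma star_obsX (a : K.cell n →₀ G) : star (obsX a) = obsX (-a) := Subtype.ext (star_opX a)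

lemma star_obsZ (b : K.cell n →₀ DualGroup G) : star (obsZ b) = obsZ (-b) :=
  Subtype.ext (star_opZ b)

lemma obsX_mul_comm (a a' : K.cell n →₀ G) : obsX a * obsX a' = obsX a' * obsX a := by
  rw [← obsX_add, add_comm, obsX_add]

lemma obsZ_mul_comm (b b' : K.cell n →₀ DualGroup G) : obsZ b * obsZ b' = obsZ b' * obsZ b := by
  rw [← obsZ_add, add_comm, obsZ_add]

lemma star_mem_stabilizers {T : QuasiLocal (K.cell n) G} (hT : T ∈ K.stabilizers n G) :
    star T ∈ K.stabilizers n G := by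
  obtain ⟨c, d, rfl⟩ := hT
  refine ⟨-c, -d, ?_⟩
  rw [star_mul, star_obsX, star_obsZ, obsZ_mul_obsX, pairing_neg_left, map_neg, pairing_boundary_coboundary,
    map_neg, map_neg]
  simp

lemma stabilizers_subset : K.stabilizers n G ⊆ K.stabilizerAlgebra n G :=
  Submodule.subset_span.trans (Submodule.le_topologicalClosure _)

/-- An element that commutes with the unitaries `X^{∂ᵀc} Z^{∂d}` lies in the commutant. -/
lemma mem_commutant_of_commute {T : QuasiLocal (K.cell n) G}
    (h : ∀ V ∈ K.stabilizers n G, V * T = T * V) : T ∈ K.commutant n G := by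
  have h1 : ∀ V ∈ K.stabilizerAlgebra n G, V * T = T * V := by
    intro V hV
    have hc : IsClosed {V : QuasiLocal (K.cell n) G | V * T = T * V} :=
      isClosed_eq (continuous_id.mul continuous_const) (continuous_const.mul continuous_id)
    refine closure_minimal ?_ hc hV
    intro V hV
    induction hV using Submodule.span_induction with
    | mem V hV => exact h V hV
    | zero => simp
    | add V W _ _ hV hW =>
      change (V + W) * T = T * (V + W)
      rw [add_mul, mul_add, hV, hW]
    | smul r V _ hV =>
      change (r • V) * T = T * (r • V)
      rw [smul_mul_assoc, mul_smul_comm, hV]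
  have h2 : ∀ V ∈ K.stabilizerAlgebra n G, star V ∈ K.stabilizerAlgebra n G := by
    intro V hV
    refine map_mem_closure continuous_star hV ?_
    intro V hV
    induction hV using Submodule.span_induction with
    | mem V hV => exact Submodule.subset_span (star_mem_stabilizers hV)
    | zero => simp
    | add V W _ _ hV hW =>
      rw [star_add]
      exact add_mem hV hW
    | smul r V _ hV =>
      rw [star_smul]
      exact Submodule.smul_mem _ _ hV
  exact StarSubalgebra.mem_centralizer_iff ℂ |>.2 fun V hV => ⟨h1 V hV, h1 _ (h2 V hV)⟩

lemma commute_of_mem_commutant {T : QuasiLocal (K.cell n) G} (hT : T ∈ K.commutant n G)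
    {V : QuasiLocal (K.cell n) G} (hV : V ∈ K.stabilizers n G) : V * T = T * V :=
  ((StarSubalgebra.mem_centralizer_iff ℂ).1 hT V (stabilizers_subset hV)).1

lemma commute_cycle_X {b : K.cell n →₀ DualGroup G} (hb : b ∈ K.cycles n (DualGroup G))
    (c : K.CellBelow n →₀ G) :
    obsZ b * obsX (K.coboundaryBelow n G c) = obsX (K.coboundaryBelow n G c) * obsZ b := by
  have hb' : K.boundaryBelow n _ b = 0 := hb
  rw [obsZ_mul_obsX, ← pairing_boundaryBelow, hb']
  simp

lemma commute_cocycle_Z {a : K.cell n →₀ G} (ha : a ∈ K.cocycles n G)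
    (d : K.cell (n + 1) →₀ DualGroup G) :
    obsZ (K.boundary n _ d) * obsX a = obsX a * obsZ (K.boundary n _ d) := by
  have ha' : K.coboundary n _ a = 0 := ha
  rw [obsZ_mul_obsX, pairing_boundary, ha']
  simp

lemma pauli_mem_commutant {a : K.cell n →₀ G} (ha : a ∈ K.cocycles n G)
    {b : K.cell n →₀ DualGroup G} (hb : b ∈ K.cycles n (DualGroup G)) :
    obsX a * obsZ b ∈ K.commutant n G := by
  refine mem_commutant_of_commute ?_
  rintro _ ⟨c, d, rfl⟩
  rw [mul_assoc, ← mul_assoc (obsZ _) (obsX a), commute_cocycle_Z ha, mul_assoc (obsX a),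
    ← mul_assoc, obsX_mul_comm, obsZ_mul_comm, mul_assoc, ← mul_assoc _ (obsZ b),
    ← commute_cycle_X hb]
  simp only [mul_assoc]

lemma coboundary_mem_cocycles (c : K.CellBelow n →₀ G) :
    K.coboundaryBelow n G c ∈ K.cocycles n G := by
  by_contra h
  obtain ⟨β, hβ⟩ := Finsupp.ne_iff.1 (show K.coboundary n G (K.coboundaryBelow n G c) ≠ 0 from h)
  obtain ⟨χ, hχ⟩ := exists_dual_ne_zero hβ
  rw [← pairing_single_left, ← pairing_boundary, pairing_boundary_coboundary] at hχ
  exact hχ rfl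

lemma boundary_mem_cycles (d : K.cell (n + 1) →₀ DualGroup G) :
    K.boundary n _ d ∈ K.cycles n (DualGroup G) :=
  boundaryBelow_boundary K n (DualGroup G) d

variable (K n G) in
/-- The elements `X^a Z^b` of the commutant with `∂ᵀa = 0` and `∂b = 0`. -/
def cycleElements : Set ↥(K.commutant n G) :=
  {T | ∃ a ∈ K.cocycles n G, ∃ b ∈ K.cycles n (DualGroup G),
    (T : QuasiLocal (K.cell n) G) = obsX a * obsZ b}

/-- The commutant is the closed linear span of the elements `X^a Z^b` with `∂ᵀa = 0`, `∂b = 0`. -/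
lemma mem_closure_cycleElements [Finite G] (T : ↥(K.commutant n G)) :
    T ∈ closure (Submodule.span ℂ (K.cycleElements n G) : Set ↥(K.commutant n G)) := by
  refine Metric.mem_closure_iff.2 fun ε hε => ?_
  have hX : ∀ c, T.1.1 * opX (K.coboundaryBelow n G c) =
      opX (K.coboundaryBelow n G c) * T.1.1 := fun c => by
    have h := commute_of_mem_commutant T.2 (V := obsX (K.coboundaryBelow n G c))
      ⟨c, 0, by rw [map_zero, obsZ_zero, mul_one]⟩
    exact (congrArg Subtype.val h).symm
  have hZ : ∀ d, T.1.1 * opZ (K.boundary n _ d) = opZ (K.boundary n _ d) * T.1.1 := fun d => by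
    have h := commute_of_mem_commutant T.2 (V := obsZ (K.boundary n _ d))
      ⟨0, d, by rw [map_zero, obsX_zero, one_mul]⟩
    exact (congrArg Subtype.val h).symm
  obtain ⟨T₁, hT₁, hlt⟩ := exists_cycle_approx T.1.2 hX hZ hε
  have hlift : ∃ T₂ ∈ Submodule.span ℂ (K.cycleElements n G), T₂.1.1 = T₁ := by
    clear hlt
    induction hT₁ using Submodule.span_induction with
    | mem x hx =>
      obtain ⟨a, ha, b, hb, rfl⟩ := hx
      exact ⟨⟨obsX a * obsZ b, pauli_mem_commutant ha hb⟩,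
        Submodule.subset_span ⟨a, ha, b, hb, rfl⟩, rfl⟩
    | zero => exact ⟨0, zero_mem _, rfl⟩
    | add x y _ _ hx hy =>
      obtain ⟨x', hx', rfl⟩ := hx
      obtain ⟨y', hy', rfl⟩ := hy
      exact ⟨x' + y', add_mem hx' hy', rfl⟩
    | smul r x _ hx =>
      obtain ⟨x', hx', rfl⟩ := hx
      exact ⟨r • x', Submodule.smul_mem _ _ hx', rfl⟩
  obtain ⟨T₂, hT₂, rfl⟩ := hlift
  exact ⟨T₂, hT₂, by
    rw [dist_eq_norm]
    exact hlt⟩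

end IncidenceData

namespace IncidenceData

variable {K : IncidenceData.{u}} {n : ℕ} {G : Type v} [AddCommGroup G]

lemma relation_eq {a : K.cell n →₀ G} {b : K.cell n →₀ DualGroup G}
    (hb : b ∈ K.cycles n (DualGroup G)) (c : K.CellBelow n →₀ G)
    (d : K.cell (n + 1) →₀ DualGroup G) :
    obsX a * obsZ b - obsX (a + K.coboundaryBelow n G c) * obsZ (b + K.boundary n _ d) =
      obsX a * obsZ b * (1 - obsX (K.coboundaryBelow n G c) * obsZ (K.boundary n _ d)) := by
  rw [mul_sub, mul_one, obsX_add, obsZ_add, mul_assoc (obsX a), ← mul_assoc _ (obsZ b),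
    ← commute_cycle_X hb]
  simp only [mul_assoc]

lemma logicalRelations_subset : K.logicalRelations n G ⊆ K.logicalSubspace n G :=
  Submodule.subset_span.trans (Submodule.le_topologicalClosure _)

lemma cycle_mul_relation {E T : ↥(K.commutant n G)} (hE : E ∈ K.cycleElements n G)
    (hT : T ∈ K.logicalRelations n G) : E * T ∈ K.logicalSubspace n G := by
  obtain ⟨a', ha', b', hb', hE⟩ := hE
  obtain ⟨a, ha, b, hb, c, d, hT⟩ := hT
  have hgen : (⟨obsX (a' + a) * obsZ (b' + b), pauli_mem_commutant (add_mem ha' ha)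
      (add_mem hb' hb)⟩ - ⟨obsX (a' + a + K.coboundaryBelow n G c) *
        obsZ (b' + b + K.boundary n _ d), pauli_mem_commutant
        (add_mem (add_mem ha' ha) (coboundary_mem_cocycles c))
        (add_mem (add_mem hb' hb) (boundary_mem_cycles d))⟩ : ↥(K.commutant n G)) ∈
      K.logicalRelations n G :=
    ⟨_, add_mem ha' ha, _, add_mem hb' hb, c, d, rfl⟩
  have h := Submodule.smul_mem _ (phase (pairing b' a)) (logicalRelations_subset hgen)
  have e : E * T = phase (pairing b' a) • (⟨obsX (a' + a) * obsZ (b' + b),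
      pauli_mem_commutant (add_mem ha' ha) (add_mem hb' hb)⟩ -
      ⟨obsX (a' + a + K.coboundaryBelow n G c) * obsZ (b' + b + K.boundary n _ d),
        pauli_mem_commutant (add_mem (add_mem ha' ha) (coboundary_mem_cocycles c))
        (add_mem (add_mem hb' hb) (boundary_mem_cycles d))⟩ : ↥(K.commutant n G)) := by
    refine Subtype.ext ?_
    change E.1 * T.1 = phase (pairing b' a) • (obsX (a' + a) * obsZ (b' + b) -
      obsX (a' + a + K.coboundaryBelow n G c) * obsZ (b' + b + K.boundary n _ d))
    rw [hE, hT, relation_eq hb, relation_eq (add_mem hb' hb), ← smul_mul_assoc, ← mul_assoc]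
    congr 1
    exact Subtype.ext (pauli_mul a' a b' b)
  rw [e]
  exact h

lemma relation_mul_cycle {E T : ↥(K.commutant n G)} (hE : E ∈ K.cycleElements n G)
    (hT : T ∈ K.logicalRelations n G) : T * E ∈ K.logicalSubspace n G := by
  obtain ⟨a, ha, b, hb, c, d, hT'⟩ := id hT
  have hU : (obsX (K.coboundaryBelow n G c) * obsZ (K.boundary n _ d)) * E.1 =
      E.1 * (obsX (K.coboundaryBelow n G c) * obsZ (K.boundary n _ d)) :=
    commute_of_mem_commutant E.2 ⟨c, d, rfl⟩
  obtain ⟨a', ha', b', hb', hE'⟩ := id hE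
  have hswap : obsX a * obsZ b * E.1 =
      (phase (pairing b a') * star (phase (pairing b' a))) • (E.1 * (obsX a * obsZ b)) := by
    have h1 : obsX a * obsZ b * (obsX a' * obsZ b') = phase (pairing b a') •
        (obsX (a + a') * obsZ (b + b')) := Subtype.ext (pauli_mul a a' b b')
    have h2 : obsX a' * obsZ b' * (obsX a * obsZ b) = phase (pairing b' a) •
        (obsX (a' + a) * obsZ (b' + b)) := Subtype.ext (pauli_mul a' a b' b)
    rw [hE', h1, h2, smul_smul, mul_assoc, ← phase_neg, ← phase_add, neg_add_cancel, phase_zero,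
      mul_one, add_comm a, add_comm b]
  have e : T * E = (phase (pairing b a') * star (phase (pairing b' a))) • (E * T) := by
    refine Subtype.ext ?_
    change T.1 * E.1 = (phase (pairing b a') * star (phase (pairing b' a))) • (E.1 * T.1)
    rw [hT', relation_eq hb, mul_assoc, sub_mul, one_mul, hU, mul_sub, ← mul_assoc, ← mul_assoc,
      hswap, mul_sub, mul_one, mul_sub, smul_sub, smul_mul_assoc]
    simp only [mul_assoc, smul_mul_assoc]
  rw [e]
  exact Submodule.smul_mem _ _ (cycle_mul_relation hE hT)

lemma mem_of_closure_span {A : Type*} [Ring A] [Algebra ℂ A] [TopologicalSpace A] {s : Set A}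
    {J : Submodule ℂ A} (hJ : IsClosed (J : Set A)) (f : A →ₗ[ℂ] A) (hf : Continuous f)
    (h : ∀ x ∈ s, f x ∈ J) {x : A} (hx : x ∈ closure (Submodule.span ℂ s : Set A)) : f x ∈ J :=
  closure_minimal (s := (Submodule.span ℂ s : Set A)) (t := (J.comap f : Set A))
    (Submodule.span_le.2 h) (hJ.preimage hf) hx

lemma isClosed_logicalSubspace :
    IsClosed (K.logicalSubspace n G : Set ↥(K.commutant n G)) :=
  Submodule.isClosed_topologicalClosure _

lemma mul_mem_logicalSubspace [Finite G] (T : ↥(K.commutant n G)) {j : ↥(K.commutant n G)}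
    (hj : j ∈ K.logicalSubspace n G) : T * j ∈ K.logicalSubspace n G :=
  mem_of_closure_span (isClosed_logicalSubspace (K := K) (n := n) (G := G)) (LinearMap.mulLeft ℂ T)
    (continuous_const.mul continuous_id)
    (fun j hj => mem_of_closure_span (isClosed_logicalSubspace (K := K) (n := n) (G := G)) (LinearMap.mulRight ℂ j)
      (continuous_id.mul continuous_const)
      (fun _ hE => cycle_mul_relation hE hj) (mem_closure_cycleElements T)) hj

lemma logicalSubspace_mul_mem [Finite G] (T : ↥(K.commutant n G)) {j : ↥(K.commutant n G)}
    (hj : j ∈ K.logicalSubspace n G) : j * T ∈ K.logicalSubspace n G :=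
  mem_of_closure_span (isClosed_logicalSubspace (K := K) (n := n) (G := G)) (LinearMap.mulRight ℂ T)
    (continuous_id.mul continuous_const)
    (fun j hj => mem_of_closure_span (isClosed_logicalSubspace (K := K) (n := n) (G := G)) (LinearMap.mulLeft ℂ j)
      (continuous_const.mul continuous_id)
      (fun _ hE => relation_mul_cycle hE hj) (mem_closure_cycleElements T)) hj

lemma star_mem_logicalSubspace {j : ↥(K.commutant n G)}
    (hj : j ∈ K.logicalSubspace n G) : star j ∈ K.logicalSubspace n G := by
  refine map_mem_closure continuous_star hj ?_
  intro j hj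
  induction hj using Submodule.span_induction with
  | zero => simp
  | add V W _ _ hV hW =>
    rw [star_add]
    exact add_mem hV hW
  | smul r V _ hV =>
    rw [star_smul]
    exact Submodule.smul_mem _ _ hV
  | mem T hT =>
    obtain ⟨a, ha, b, hb, c, d, hT⟩ := hT
    have hgen : (⟨obsX (-a) * obsZ (-b), pauli_mem_commutant (neg_mem ha) (neg_mem hb)⟩ -
        ⟨obsX (-a + K.coboundaryBelow n G (-c)) * obsZ (-b + K.boundary n _ (-d)),
          pauli_mem_commutant (add_mem (neg_mem ha) (coboundary_mem_cocycles _))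
          (add_mem (neg_mem hb) (boundary_mem_cycles _))⟩ : ↥(K.commutant n G)) ∈
        K.logicalRelations n G :=
      ⟨_, neg_mem ha, _, neg_mem hb, -c, -d, rfl⟩
    have e : star T = phase (pairing b a) •
        (⟨obsX (-a) * obsZ (-b), pauli_mem_commutant (neg_mem ha) (neg_mem hb)⟩ -
        ⟨obsX (-a + K.coboundaryBelow n G (-c)) * obsZ (-b + K.boundary n _ (-d)),
          pauli_mem_commutant (add_mem (neg_mem ha) (coboundary_mem_cocycles _))
          (add_mem (neg_mem hb) (boundary_mem_cycles _))⟩ : ↥(K.commutant n G)) := by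
      refine Subtype.ext ?_
      change star T.1 = phase (pairing b a) • (obsX (-a) * obsZ (-b) -
        obsX (-a + K.coboundaryBelow n G (-c)) * obsZ (-b + K.boundary n _ (-d)))
      have h1 : ∀ (a : K.cell n →₀ G) (b : K.cell n →₀ DualGroup G),
          star (obsX a * obsZ b) = phase (pairing b a) • (obsX (-a) * obsZ (-b)) :=
        fun a b => Subtype.ext (star_pauli a b)
      have h2 : pairing (b + K.boundary n _ d) (a + K.coboundaryBelow n G c) = pairing b a := by
        have ha' : K.coboundary n _ a = 0 := ha
        have hb' : K.boundaryBelow n _ b = 0 := hb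
        rw [map_add, map_add, AddMonoidHom.add_apply, AddMonoidHom.add_apply,
          pairing_boundary_coboundary, ← pairing_boundaryBelow, hb', pairing_boundary, ha']
        simp
      rw [hT, star_sub, h1, h1, h2, smul_sub, map_neg, map_neg, neg_add, neg_add]
    rw [e]
    exact Submodule.smul_mem _ _ (Submodule.subset_span hgen)

variable (K n G) [Finite G]

/-- The closed two-sided ideal `J` of `𝔄_XZ'`: the closed linear span of the elements
`X^a Z^b - X^{a+∂ᵀc} Z^{b+∂d}` with `∂ᵀa = 0` and `∂b = 0`. -/
def logicalIdeal : Ideal ↥(K.commutant n G) where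
  carrier := K.logicalSubspace n G
  add_mem' := add_mem
  zero_mem' := zero_mem _
  smul_mem' T _ hj := mul_mem_logicalSubspace T hj

instance : (K.logicalIdeal n G).IsTwoSided where
  mul_mem_of_left T hj := logicalSubspace_mul_mem T hj

/-- The algebra of logical observables `𝔄_logical = 𝔄_XZ' / J`. -/
def LogicalAlgebra : Type (max u v) := ↥(K.commutant n G) ⧸ K.logicalIdeal n G

instance : Ring (LogicalAlgebra K n G) :=
  inferInstanceAs (Ring (↥(K.commutant n G) ⧸ K.logicalIdeal n G))

instance : Algebra ℂ (LogicalAlgebra K n G) :=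
  inferInstanceAs (Algebra ℂ (↥(K.commutant n G) ⧸ K.logicalIdeal n G))

/-- The quotient map `p : 𝔄_XZ' → 𝔄_logical`. -/
def toLogical : ↥(K.commutant n G) →ₐ[ℂ] LogicalAlgebra K n G :=
  Ideal.Quotient.mkₐ ℂ (K.logicalIdeal n G)

lemma toLogical_surjective : Function.Surjective (K.toLogical n G) :=
  Ideal.Quotient.mk_surjective

lemma toLogical_eq_iff (x y : ↥(K.commutant n G)) :
    K.toLogical n G x = K.toLogical n G y ↔ x - y ∈ K.logicalSubspace n G :=
  Ideal.Quotient.eq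

/-- The involution of `𝔄_logical`, induced by that of `𝔄_XZ'`. -/
instance : Star (LogicalAlgebra K n G) where
  star := Quotient.lift (fun x => K.toLogical n G (star x)) (by
    intro x y h
    refine (toLogical_eq_iff K n G _ _).2 ?_
    have e : star x - star y = star (x - y) := (star_sub x y).symm
    rw [e]
    exact star_mem_logicalSubspace ((toLogical_eq_iff K n G x y).1 (Quotient.sound h)))

lemma star_toLogical (x : ↥(K.commutant n G)) :
    star (K.toLogical n G x) = K.toLogical n G (star x) := rfl

instance : StarRing (LogicalAlgebra K n G) where
  star_involutive x := by
    obtain ⟨x, rfl⟩ := K.toLogical_surjective n G x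
    rw [star_toLogical, star_toLogical, star_star]
  star_mul x y := by
    obtain ⟨x, rfl⟩ := K.toLogical_surjective n G x
    obtain ⟨y, rfl⟩ := K.toLogical_surjective n G y
    rw [← map_mul, star_toLogical, star_toLogical, star_toLogical, star_mul, map_mul]
  star_add x y := by
    obtain ⟨x, rfl⟩ := K.toLogical_surjective n G x
    obtain ⟨y, rfl⟩ := K.toLogical_surjective n G y
    rw [← map_add, star_toLogical, star_toLogical, star_toLogical, star_add, map_add]

instance : StarModule ℂ (LogicalAlgebra K n G) where
  star_smul r x := by
    obtain ⟨x, rfl⟩ := K.toLogical_surjective n G x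
    rw [← map_smul, star_toLogical, star_toLogical, star_smul, map_smul]

end IncidenceData

/-- A state on a unital C*-algebra: a linear functional `ω` with `ω(x* x) ≥ 0` and `ω(1) = 1`. -/
structure State (A : Type*) [Ring A] [StarRing A] [Algebra ℂ A] where
  toLinearMap : A →ₗ[ℂ] ℂ
  nonneg : ∀ x, ∃ r : ℝ, 0 ≤ r ∧ toLinearMap (star x * x) = r
  map_one : toLinearMap 1 = 1

namespace IncidenceData

variable (K : IncidenceData.{u}) (n : ℕ) (G : Type v) [AddCommGroup G]

variable {K n G} in
/-- The star operator `A_α = |G|⁻¹ ∑_g X^{∂ᵀ(g e_α)}` of an `(n-1)`-cell `α`. -/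
def starOperator (α : K.CellBelow n) : QuasiLocal (K.cell n) G :=
  (Nat.card G : ℂ)⁻¹ • ∑ᶠ g : G, obsX (K.coboundaryBelow n G (Finsupp.single α g))

variable {K n G} in
/-- The plaquette operator `B_β = |G|⁻¹ ∑_χ Z^{∂(χ e_β)}` of an `(n+1)`-cell `β`. -/
def plaquetteOperator (β : K.cell (n + 1)) : QuasiLocal (K.cell n) G :=
  (Nat.card G : ℂ)⁻¹ • ∑ᶠ χ : DualGroup G, obsZ (K.boundary n _ (Finsupp.single β χ))

/-- Frustration-free ground states: the states of the quasi-local algebra that minimize the energy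
of every interaction term `-A_α`, `-B_β` of the Hamiltonian. -/
def GroundState : Type (max u v) :=
  {ω : State (QuasiLocal (K.cell n) G) //
    (∀ α : K.CellBelow n, ω.toLinearMap (starOperator α) = 1) ∧
    (∀ β : K.cell (n + 1), ω.toLinearMap (plaquetteOperator β) = 1)}

end IncidenceData

end KitaevModel

end

/-! The commutant of the stabilizers is the closed span of the `X^a Z^b` with `a` a cocycle and
`b` a cycle, and dividing by `J` identifies cohomologous cocycles and homologous cycles.

*Ground states.* In a ground state the stabilizers `X^{∂ᵀc}`, `Z^{∂d}` have expectation `1`,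
because their averages `A_α`, `B_β` do; by the Cauchy–Schwarz inequality, multiplying by them does
not change expectations. So a ground state vanishes on `J` and induces a state of the algebra of
logical observables, and it vanishes at every `X^a Z^b` that does not commute with the
stabilizers. Hence it is determined by the induced state. Conversely, a state of the algebra of
logical observables is a contractive functional on the commutant; a Hahn–Banach extension of it to
the quasi-local algebra is a contractive unital functional, hence a state, and it is a ground
state since stabilizers have class `1`.

*Structure.* The classes of the `X^a Z^b` with `[a]`, `[b]` in the (co)homology groups span the
algebra of logical observables. They are linearly independent: for each character `χ` of `H_n`
there is a ground state with expectation `e^{2πiχ([b])}` at `Z^b` and `0` at `X^a Z^b` for `[a] ≠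
0` (`IncidenceData.exists_groundState_of_hom`). It is a limit of uniform superpositions of
coboundaries shifted by configurations of growing support. Ground states whose shifts have
infinite support in the limit are needed to separate homology classes that pair trivially with all
of `H^n_lf`.

So the algebra is the twisted group algebra of `H^n_lf × H_n` for the cocycle given by the
pairing. Such an algebra is a tensor product (`exists_starAlgEquiv_of_basis`): characters of the
two annihilators give the commutative factor, and shifts and phases on functions on `H^n_lf`
modulo its annihilator give all matrices. The dimensions match as the pairing is perfect on the
quotients by the annihilators. -/

noncomputable section

namespace KitaevModel

/-! ### States of unital C*-algebras -/

namespace State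

section Algebraic

variable {A : Type*} [Ring A] [StarRing A] [Algebra ℂ A]

lemma eq_zero_of_affine_nonneg {R γ : ℂ} (h : ∀ s : ℝ, ∃ r : ℝ, 0 ≤ r ∧ R + s * γ = r) : γ = 0 := by
  obtain ⟨r₀, -, h0⟩ := h 0
  obtain ⟨r₁, -, h1⟩ := h 1
  have hR : R = r₀ := by simpa using h0
  have hγ : γ = ((r₁ - r₀ : ℝ) : ℂ) := by
    push_cast
    rw [← h1, ← hR]
    simp
  by_contra hne
  have hne' : r₁ - r₀ ≠ 0 := fun h0 => hne (by rw [hγ, h0, Complex.ofReal_zero])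
  obtain ⟨r, hr, h2⟩ := h (-(r₀ + 1) / (r₁ - r₀))
  rw [hγ, hR, ← Complex.ofReal_mul, ← Complex.ofReal_add, Complex.ofReal_inj,
    div_mul_cancel₀ _ hne'] at h2
  linarith

variable [StarModule ℂ A]

lemma map_star_mul_self_add_smul (ω : State A) (x y : A) (t : ℂ) :
    ω.toLinearMap (star (y + t • x) * (y + t • x)) = ω.toLinearMap (star y * y) +
      (t * ω.toLinearMap (star y * x) + star t * ω.toLinearMap (star x * y)) +
      star t * t * ω.toLinearMap (star x * x) := by
  simp only [star_add, star_smul, add_mul, mul_add, smul_mul_assoc, mul_smul_comm, map_add,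
    map_smul, smul_eq_mul]
  ring

/-- The degenerate case of the Cauchy–Schwarz inequality. -/
lemma map_mul_eq_zero (ω : State A) {x : A} (hx : ω.toLinearMap (star x * x) = 0) (y : A) :
    ω.toLinearMap (star y * x) = 0 ∧ ω.toLinearMap (star x * y) = 0 := by
  -- positivity at `y + t x` for real `t` and for `t` purely imaginary
  have h1 := eq_zero_of_affine_nonneg (R := ω.toLinearMap (star y * y))
    (γ := ω.toLinearMap (star y * x) + ω.toLinearMap (star x * y)) fun s => by
      obtain ⟨r, hr, h⟩ := ω.nonneg (y + (s : ℂ) • x)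
      refine ⟨r, hr, ?_⟩
      rw [← h, map_star_mul_self_add_smul, hx]
      simp [mul_add]
  have h2 := eq_zero_of_affine_nonneg (R := ω.toLinearMap (star y * y))
    (γ := Complex.I * (ω.toLinearMap (star y * x) - ω.toLinearMap (star x * y))) fun s => by
      obtain ⟨r, hr, h⟩ := ω.nonneg (y + (s * Complex.I : ℂ) • x)
      refine ⟨r, hr, ?_⟩
      rw [← h, map_star_mul_self_add_smul, hx]
      simp
      ring
  have h3 := sub_eq_zero.1 ((mul_eq_zero.1 h2).resolve_left Complex.I_ne_zero)
  rw [← h3, ← two_mul] at h1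
  have h4 := (mul_eq_zero.1 h1).resolve_left two_ne_zero
  exact ⟨h4, h3 ▸ h4⟩

lemma map_star (ω : State A) (x : A) : ω.toLinearMap (star x) = star (ω.toLinearMap x) := by
  obtain ⟨r, -, hr⟩ := ω.nonneg x
  obtain ⟨r₁, -, h1⟩ := ω.nonneg (1 + (1 : ℂ) • x)
  obtain ⟨r₂, -, h2⟩ := ω.nonneg (1 + Complex.I • x)
  rw [map_star_mul_self_add_smul, hr] at h1 h2
  simp only [star_one, mul_one, one_mul, ω.map_one] at h1 h2
  have h1' := congrArg Complex.im h1
  have h2' := congrArg Complex.im h2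
  simp at h1' h2'
  apply Complex.ext <;> simp <;> linarith

/-- The Cauchy–Schwarz inequality for `x` and `1`, from the positivity of `ω` at `x - ω(x) 1`. -/
lemma normSq_map_le (ω : State A) (x : A) :
    ‖ω.toLinearMap x‖ ^ 2 ≤ (ω.toLinearMap (star x * x)).re := by
  obtain ⟨r, hr, h⟩ := ω.nonneg (x + (-ω.toLinearMap x) • 1)
  rw [map_star_mul_self_add_smul] at h
  simp only [star_one, mul_one, one_mul, ω.map_one, map_star] at h
  have h' := congrArg Complex.re h
  simp only [Complex.add_re, Complex.mul_re, Complex.neg_re, Complex.neg_im, star_neg,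
    Complex.star_def, Complex.conj_re, Complex.conj_im, Complex.ofReal_re] at h'
  rw [← Complex.normSq_eq_norm_sq, Complex.normSq_apply]
  linarith

end Algebraic

section CStar

variable {A : Type*} [CStarAlgebra A]

lemma norm_one_le : ‖(1 : A)‖ ≤ 1 := by
  rcases subsingleton_or_nontrivial A with h | h
  · rw [Subsingleton.elim (1 : A) 0, norm_zero]
    exact zero_le_one
  · exact CStarRing.norm_one.le

/-- States are contractive, since `‖x‖² - x* x` is of the form `y* y`. -/
lemma norm_map_le (ω : State A) (x : A) : ‖ω.toLinearMap x‖ ≤ ‖x‖ := by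
  let _ := CStarAlgebra.spectralOrder A
  have _ := CStarAlgebra.spectralOrderedRing A
  have h : 0 ≤ algebraMap ℝ A (‖x‖ ^ 2) - star x * x :=
    sub_nonneg.2 CStarAlgebra.star_mul_le_algebraMap_norm_sq
  obtain ⟨y, hy⟩ := CStarAlgebra.nonneg_iff_eq_star_mul_self.1 h
  obtain ⟨r, hr, h1⟩ := ω.nonneg y
  rw [← hy, map_sub, Algebra.algebraMap_eq_smul_one, ← Complex.coe_smul, map_smul, ω.map_one] at h1
  have h2 := congrArg Complex.re h1
  have h3 := ω.normSq_map_le x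
  simp only [Complex.sub_re, smul_eq_mul, mul_one, Complex.ofReal_re] at h2
  exact le_of_sq_le_sq (by linarith) (norm_nonneg _)

/-- Unital contractive functionals are real on self-adjoint elements: `‖x + it‖² ≤ ‖x‖² + t²` for
all real `t`, while an imaginary part of the value at `x` would make `|f(x) + it|²` grow faster. -/
lemma im_eq_zero_of_contractive (f : A →ₗ[ℂ] ℂ) (hf : ∀ x, ‖f x‖ ≤ ‖x‖) (h1 : f 1 = 1) {x : A}
    (hx : star x = x) : (f x).im = 0 := by
  have key : ∀ t : ℝ, ((f x).im + t) ^ 2 ≤ ‖x‖ ^ 2 + t ^ 2 * ‖(1 : A)‖ := by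
    intro t
    have h2 : ‖f (x + (t * Complex.I : ℂ) • 1)‖ ≤ _ := hf _
    have h3 : ‖x + (t * Complex.I : ℂ) • (1 : A)‖ ^ 2 ≤ ‖x‖ ^ 2 + t ^ 2 * ‖(1 : A)‖ := by
      rw [sq, ← CStarRing.norm_star_mul_self]
      have : star (x + (t * Complex.I : ℂ) • (1 : A)) * (x + (t * Complex.I : ℂ) • (1 : A)) =
          x * x + ((t ^ 2 : ℝ) : ℂ) • (1 : A) := by
        simp only [star_add, hx, star_smul, star_one, add_mul, mul_add, smul_mul_assoc,
          mul_smul_comm, mul_one, one_mul]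
        simp only [Complex.star_def, map_mul, Complex.conj_ofReal, Complex.conj_I]
        have e : ((t ^ 2 : ℝ) : ℂ) = t * Complex.I * (t * -Complex.I) := by
          push_cast
          linear_combination (t : ℂ) ^ 2 * Complex.I_sq
        rw [e]
        module
      rw [this]
      refine (norm_add_le _ _).trans (add_le_add ((norm_mul_le _ _).trans (sq _).ge) ?_)
      rw [norm_smul]
      simp
    refine le_trans ?_ ((pow_le_pow_left₀ (norm_nonneg _) h2 2).trans h3)
    rw [map_add, map_smul, h1, ← Complex.normSq_eq_norm_sq, Complex.normSq_apply]
    simp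
    nlinarith [sq_nonneg (f x).re]
  by_contra hne
  -- at this `t` the linear term `2 t Im f(x)` of `(Im f(x) + t)²` is `‖x‖² + 1`
  have h5 := key ((‖x‖ ^ 2 + 1) / (2 * (f x).im))
  have h6 : 2 * (f x).im * ((‖x‖ ^ 2 + 1) / (2 * (f x).im)) = ‖x‖ ^ 2 + 1 := by field_simp
  have h7 := mul_le_mul_of_nonneg_left (norm_one_le (A := A)) (sq_nonneg ((‖x‖ ^ 2 + 1) / (2 * (f x).im)))
  nlinarith [sq_nonneg (f x).im]

/-- A unital linear functional of norm at most `1` on a C*-algebra is a state. -/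
def ofContractive (f : A →ₗ[ℂ] ℂ) (hf : ∀ x, ‖f x‖ ≤ ‖x‖) (h1 : f 1 = 1) : State A where
  toLinearMap := f
  map_one := h1
  nonneg x := by
    let _ := CStarAlgebra.spectralOrder A
    have _ := CStarAlgebra.spectralOrderedRing A
    have him := im_eq_zero_of_contractive f hf h1 (x := star x * x) (by simp)
    have h0 : 0 ≤ star x * x := star_mul_self_nonneg x
    refine ⟨(f (star x * x)).re, ?_, Complex.ext rfl him⟩
    -- `‖s - x* x‖ ≤ s` for `s = ‖x* x‖`, so the value at `x* x` is at distance at most `s` from `s`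
    have h2 : star x * x ≤ algebraMap ℝ A ‖star x * x‖ := IsSelfAdjoint.le_algebraMap_norm_self
    have h3 : ‖algebraMap ℝ A ‖star x * x‖ - star x * x‖ ≤ ‖algebraMap ℝ A ‖star x * x‖‖ :=
      CStarAlgebra.norm_le_norm_of_nonneg_of_le (sub_nonneg.2 h2) (sub_le_self _ h0)
    have h4 : ‖algebraMap ℝ A ‖star x * x‖‖ ≤ ‖star x * x‖ := by
      rw [norm_algebraMap, norm_norm]
      exact mul_le_of_le_one_right (norm_nonneg _) norm_one_le
    have h5 := ((Complex.abs_re_le_norm _).trans (hf _)).trans (h3.trans h4)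
    rw [map_sub, Algebra.algebraMap_eq_smul_one, ← Complex.coe_smul, map_smul, h1] at h5
    simp only [Complex.sub_re, smul_eq_mul, mul_one, Complex.ofReal_re] at h5
    linarith [(abs_le.1 h5).2]

end CStar

end State

/-! ### Duality of finite abelian groups -/

section Duality

lemma phase_injective : Function.Injective phase := fun _ _ h =>
  phaseHom_injective (Circle.ext h)

lemma star_phase_mul_phase (x : AddCircle (1 : ℚ)) : star (phase x) * phase x = 1 := by
  rw [← phase_neg, ← phase_add, neg_add_cancel, phase_zero]

variable {G : Type v} [AddCommGroup G]

lemma card_dualGroup_le (G : Type v) [AddCommGroup G] [Finite G] :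
    Nat.card (DualGroup G) ≤ Nat.card G := by
  have _ := Fintype.ofFinite G
  let f : DualGroup G → AddChar G ℂ := fun χ =>
    { toFun := fun g => phase (χ g)
      map_zero_eq_one' := by simp
      map_add_eq_mul' := fun g h => by simp [phase_add] }
  have hf : Function.Injective f := fun χ χ' h => by
    ext x
    exact phase_injective (congrArg (fun f => f x) h)
  have h := Nat.card_le_card_of_injective f hf
  rwa [Nat.card_eq_fintype_card (α := AddChar G ℂ), AddChar.card_eq,
    ← Nat.card_eq_fintype_card] at h

/-- Evaluation at an element of `G`, a character of the dual group. -/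
def evalDual (g : G) : DualGroup (DualGroup G) :=
  ({ toFun := fun χ => χ g
     map_zero' := rfl
     map_add' := fun _ _ => rfl } : DualGroup G →+ AddCircle (1 : ℚ))

lemma evalDual_apply (g : G) (χ : DualGroup G) : evalDual g χ = χ g := rfl

lemma evalDual_injective : Function.Injective (evalDual (G := G)) := by
  intro g g' h
  by_contra hne
  obtain ⟨χ, hχ⟩ := exists_dual_ne_zero (sub_ne_zero.2 hne)
  refine hχ ?_
  rw [map_sub, ← evalDual_apply, h, evalDual_apply, sub_self]

lemma card_dualGroup (G : Type v) [AddCommGroup G] [Finite G] :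
    Nat.card (DualGroup G) = Nat.card G :=
  (card_dualGroup_le G).antisymm
    ((Nat.card_le_card_of_injective _ evalDual_injective).trans (card_dualGroup_le _))

/-- Pontryagin duality for finite groups. -/
lemma exists_eq_eval [Finite G] (f : DualGroup G →+ AddCircle (1 : ℚ)) :
    ∃ g : G, ∀ χ : DualGroup G, f χ = χ g := by
  have hb := (Nat.bijective_iff_injective_and_card (evalDual (G := G))).2
    ⟨evalDual_injective, by rw [card_dualGroup, card_dualGroup]⟩
  obtain ⟨g, hg⟩ := hb.2 (f : DualGroup (DualGroup G))
  exact ⟨g, fun χ => (congrArg (fun f => f χ) hg).symm⟩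

end Duality

/-! ### Ground states and states of the algebra of logical observables -/

section GroundStates

/-- If the average of finitely many unitaries has expectation `1`, then multiplying by any of them
does not change expectations, as each of them has expectation `1` as well. -/
lemma State.map_mul_of_average {A : Type*} [Ring A] [StarRing A] [Algebra ℂ A] [StarModule ℂ A]
    (ω : State A) {ι : Type*} [Finite ι] {U : ι → A} (hU : ∀ i, star (U i) * U i = 1)
    (h : ω.toLinearMap ((Nat.card ι : ℂ)⁻¹ • ∑ᶠ i, U i) = 1) (i : ι) (y : A) :
    ω.toLinearMap (y * U i) = ω.toLinearMap y ∧
      ω.toLinearMap (star (U i) * y) = ω.toLinearMap y := by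
  have _ := Fintype.ofFinite ι
  have hre : ∀ i, (ω.toLinearMap (U i)).re ≤ 1 := fun i => by
    have h1 := ω.normSq_map_le (U i)
    rw [hU, ω.map_one, Complex.one_re] at h1
    exact (Complex.re_le_norm _).trans ((sq_le_one_iff₀ (norm_nonneg _)).1 h1)
  have hc : (Nat.card ι : ℂ) ≠ 0 := fun h0 => by
    rw [h0, inv_zero, zero_smul, map_zero] at h
    exact zero_ne_one h
  have hsum : ∑ i, (1 - (ω.toLinearMap (U i)).re) = 0 := by
    rw [map_smul, finsum_eq_sum_of_fintype, map_sum, smul_eq_mul, inv_mul_eq_one₀ hc] at h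
    have h2 := congrArg Complex.re h
    rw [Complex.re_sum, Complex.natCast_re] at h2
    rw [Finset.sum_sub_distrib, ← h2]
    simp
  have h1 : (ω.toLinearMap (U i)).re = 1 := by
    have := (Finset.sum_eq_zero_iff_of_nonneg fun i _ => sub_nonneg.2 (hre i)).1 hsum i
      (Finset.mem_univ i)
    linarith
  have h0 : ω.toLinearMap (star (1 - U i) * (1 - U i)) = 0 := by
    have e : star (1 - U i) * (1 - U i) = 1 + 1 - U i - star (U i) := by
      rw [star_sub, star_one, mul_sub, sub_mul, sub_mul, hU]
      noncomm_ring
    rw [e, map_sub, map_sub, map_add, ω.map_one, ω.map_star]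
    apply Complex.ext <;> simp [h1]
  have h2 := (ω.map_mul_eq_zero h0 (star y)).1
  have h3 := (ω.map_mul_eq_zero h0 y).2
  rw [star_star, mul_sub, mul_one, map_sub] at h2
  rw [star_sub, star_one, sub_mul, one_mul, map_sub] at h3
  exact ⟨(sub_eq_zero.1 h2).symm, (sub_eq_zero.1 h3).symm⟩

lemma State.ext_toLinearMap {A : Type*} [Ring A] [StarRing A] [Algebra ℂ A] {ω ω' : State A}
    (h : ω.toLinearMap = ω'.toLinearMap) : ω = ω' := by
  cases ω
  cases ω'
  congr

instance isClosed_quasiLocal (S : Type u) (G : Type v) [AddCommGroup G] :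
    IsClosed (quasiLocal S G : Set (Operators S G)) :=
  StarSubalgebra.isClosed_topologicalClosure _

/-- A state of the quasi-local algebra is determined by the expectations of the `X^a Z^b`. -/
lemma State.ext_pauli {S : Type u} {G : Type v} [AddCommGroup G] [Finite G]
    {ω ω' : State (QuasiLocal S G)}
    (h : ∀ a b, ω.toLinearMap (obsX a * obsZ b) = ω'.toLinearMap (obsX a * obsZ b)) :
    ω = ω' := by
  have hc : ∀ ω : State (QuasiLocal S G), Continuous ω.toLinearMap := fun ω =>
    (ω.toLinearMap.mkContinuous 1 fun x => by
      rw [one_mul]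
      exact ω.norm_map_le x).continuous
  have hspan : pauliSpan S G ≤ (LinearMap.eqLocus ω.toLinearMap ω'.toLinearMap).map
      (quasiLocal S G).subtype.toAlgHom.toLinearMap := by
    refine Submodule.span_le.2 ?_
    rintro _ ⟨a, b, rfl⟩
    exact ⟨obsX a * obsZ b, h a b, rfl⟩
  have key : ω.toLinearMap = ω'.toLinearMap := by
    refine LinearMap.ext fun T => ?_
    refine closure_minimal subset_rfl (isClosed_eq (hc ω) (hc ω')) ?_
    refine closure_subtype.2 ?_
    exact closure_mono hspan (quasiLocal_le_closure_pauliSpan T.2)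
  exact State.ext_toLinearMap key

lemma exists_factor {V W : Type*} [AddCommGroup V] [Module ℂ V] [AddCommGroup W] [Module ℂ W]
    (p : V →ₗ[ℂ] W) (hp : Function.Surjective p) (f : V →ₗ[ℂ] ℂ)
    (h : ∀ v, p v = 0 → f v = 0) : ∃ g : W →ₗ[ℂ] ℂ, ∀ v, g (p v) = f v := by
  obtain ⟨s, hs⟩ := p.exists_rightInverse_of_surjective (LinearMap.range_eq_top.2 hp)
  refine ⟨f ∘ₗ s, fun v => ?_⟩
  have h1 : p (s (p v) - v) = 0 := by
    rw [map_sub, sub_eq_zero]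
    exact LinearMap.congr_fun hs (p v)
  have h2 := h _ h1
  rwa [map_sub, sub_eq_zero] at h2

namespace IncidenceData

variable {K : IncidenceData.{u}} {n : ℕ} {G : Type v} [AddCommGroup G]

instance isClosed_commutant :
    IsClosed (K.commutant n G : Set (QuasiLocal (K.cell n) G)) := by
  have e : (K.commutant n G : Set (QuasiLocal (K.cell n) G)) =
      ⋂ V ∈ K.stabilizers n G, {T | V * T = T * V} := by
    ext T
    simp only [Set.mem_iInter]
    exact ⟨fun h V hV => commute_of_mem_commutant h hV, mem_commutant_of_commute⟩
  rw [e]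
  exact isClosed_biInter fun V _ =>
    isClosed_eq (continuous_const.mul continuous_id) (continuous_id.mul continuous_const)

lemma star_mul_obsX (a : K.cell n →₀ G) : star (obsX a) * obsX a = 1 := by
  rw [star_obsX, ← obsX_add, neg_add_cancel, obsX_zero]

lemma star_mul_obsZ (b : K.cell n →₀ DualGroup G) : star (obsZ b) * obsZ b = 1 := by
  rw [star_obsZ, ← obsZ_add, neg_add_cancel, obsZ_zero]

/-- The restriction of a ground state to the commutant. -/
def GroundState.restrict (ω : K.GroundState n G) : ↥(K.commutant n G) →ₗ[ℂ] ℂ :=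
  ω.1.toLinearMap ∘ₗ (K.commutant n G).subtype.toAlgHom.toLinearMap

lemma GroundState.restrict_apply (ω : K.GroundState n G) (T : ↥(K.commutant n G)) :
    ω.restrict T = ω.1.toLinearMap T := rfl

section Finite

variable [Finite G]

namespace GroundState

/-- Multiplying by `X^{∂ᵀc}` on either side does not change expectations in a ground state. -/
lemma map_mul_obsX (ω : K.GroundState n G) (c : K.CellBelow n →₀ G)
    (y : QuasiLocal (K.cell n) G) :
    ω.1.toLinearMap (y * obsX (K.coboundaryBelow n G c)) = ω.1.toLinearMap y ∧
      ω.1.toLinearMap (obsX (K.coboundaryBelow n G c) * y) = ω.1.toLinearMap y := by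
  induction c using Finsupp.induction_linear generalizing y with
  | zero => simp [obsX_zero]
  | add c c' h h' =>
    rw [map_add, obsX_add, ← mul_assoc, (h' _).1, (h _).1, mul_assoc, (h _).2, (h' _).2]
    exact ⟨rfl, rfl⟩
  | single α g =>
    have h := fun g => ω.1.map_mul_of_average (fun g => star_mul_obsX _) (ω.2.1 α) g y
    refine ⟨(h g).1, ?_⟩
    rw [← (h (-g)).2, star_obsX, ← map_neg, ← Finsupp.single_neg, neg_neg]

/-- Multiplying by `Z^{∂d}` on either side does not change expectations in a ground state. -/
lemma map_mul_obsZ (ω : K.GroundState n G) (d : K.cell (n + 1) →₀ DualGroup G)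
    (y : QuasiLocal (K.cell n) G) :
    ω.1.toLinearMap (y * obsZ (K.boundary n _ d)) = ω.1.toLinearMap y ∧
      ω.1.toLinearMap (obsZ (K.boundary n _ d) * y) = ω.1.toLinearMap y := by
  induction d using Finsupp.induction_linear generalizing y with
  | zero => simp [obsZ_zero]
  | add c c' h h' =>
    rw [map_add, obsZ_add, ← mul_assoc, (h' _).1, (h _).1, mul_assoc, (h _).2, (h' _).2]
    exact ⟨rfl, rfl⟩
  | single β χ =>
    have h1 := ω.2.2 β
    -- the prefactor of the average over the dual group is `|G|⁻¹`
    rw [plaquetteOperator, ← card_dualGroup] at h1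
    have h := fun χ => ω.1.map_mul_of_average (fun g => star_mul_obsZ _) h1 χ y
    refine ⟨(h χ).1, ?_⟩
    rw [← (h (-χ)).2, star_obsZ, ← map_neg, ← Finsupp.single_neg, neg_neg]

/-- A ground state annihilates the operators `X^a Z^b` that fail to commute with the stabilizers:
conjugation by a stabilizer multiplies such an operator by a phase different from `1`. -/
lemma map_pauli_eq_zero (ω : K.GroundState n G) {a : K.cell n →₀ G}
    {b : K.cell n →₀ DualGroup G} (h : ¬(a ∈ K.cocycles n G ∧ b ∈ K.cycles n (DualGroup G))) :
    ω.1.toLinearMap (obsX a * obsZ b) = 0 := by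
  obtain ⟨c, d, hcd⟩ := exists_detect h
  have h1 : obsX (K.coboundaryBelow n G c) * obsZ (K.boundary n _ d) * (obsX a * obsZ b) =
      phase (pairing (K.boundary n _ d) a) •
        (obsX (K.coboundaryBelow n G c + a) * obsZ (K.boundary n _ d + b)) :=
    Subtype.ext (pauli_mul _ _ _ _)
  have h2 : obsX a * obsZ b * (obsX (K.coboundaryBelow n G c) * obsZ (K.boundary n _ d)) =
      phase (pairing b (K.coboundaryBelow n G c)) •
        (obsX (K.coboundaryBelow n G c + a) * obsZ (K.boundary n _ d + b)) := by
    rw [add_comm _ a, add_comm _ b]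
    exact Subtype.ext (pauli_mul _ _ _ _)
  have h3 := congrArg ω.1.toLinearMap h1
  have h4 := congrArg ω.1.toLinearMap h2
  rw [mul_assoc, (ω.map_mul_obsX c _).2, (ω.map_mul_obsZ d _).2, map_smul, smul_eq_mul] at h3
  rw [← mul_assoc, (ω.map_mul_obsZ d _).1, (ω.map_mul_obsX c _).1, map_smul, smul_eq_mul] at h4
  have h5 : ω.1.toLinearMap (obsX (K.coboundaryBelow n G c + a) *
      obsZ (K.boundary n _ d + b)) = 0 := by
    by_contra hne
    exact hcd (phase_injective (mul_right_cancel₀ hne (h3.symm.trans h4)))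
  rw [h3, h5, mul_zero]

lemma restrict_eq_zero (ω : K.GroundState n G) {T : ↥(K.commutant n G)}
    (hT : T ∈ K.logicalSubspace n G) : restrict ω T = 0 := by
  let f := restrict ω
  have hf : Continuous f := (f.mkContinuous 1 fun x => by
    rw [one_mul]
    exact ω.1.norm_map_le x.1).continuous
  have hspan : Submodule.span ℂ (K.logicalRelations n G) ≤ LinearMap.ker f := by
    refine Submodule.span_le.2 ?_
    rintro T ⟨a, -, b, hb, c, d, hT⟩
    change restrict ω T = 0
    rw [restrict_apply, hT, relation_eq hb, mul_sub, mul_one, map_sub, ← mul_assoc, (ω.map_mul_obsZ d _).1,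
      (ω.map_mul_obsX c _).1, sub_self]
  exact closure_minimal (t := {T | f T = 0}) hspan (isClosed_eq hf continuous_const) hT

lemma exists_toLogical_factor (ω : K.GroundState n G) :
    ∃ f : K.LogicalAlgebra n G →ₗ[ℂ] ℂ,
      ∀ T : ↥(K.commutant n G), f (K.toLogical n G T) = ω.1.toLinearMap T :=
  exists_factor (K.toLogical n G).toLinearMap (K.toLogical_surjective n G) ω.restrict
    fun T hT => by
      have h : K.toLogical n G T = K.toLogical n G 0 :=
        hT.trans (map_zero (K.toLogical n G)).symm
      rw [toLogical_eq_iff, sub_zero] at h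
      exact restrict_eq_zero ω h

/-- The linear functional induced by a ground state on the algebra of logical observables. -/
def toLogicalFunctional (ω : K.GroundState n G) : K.LogicalAlgebra n G →ₗ[ℂ] ℂ :=
  (exists_toLogical_factor ω).choose

lemma toLogicalFunctional_toLogical (ω : K.GroundState n G) (T : ↥(K.commutant n G)) :
    toLogicalFunctional ω (K.toLogical n G T) = ω.1.toLinearMap T :=
  (exists_toLogical_factor ω).choose_spec T

/-- The state of the algebra of logical observables induced by a ground state. -/
def toLogicalState (ω : K.GroundState n G) : State (K.LogicalAlgebra n G) where
  toLinearMap := toLogicalFunctional ω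
  nonneg x := by
    obtain ⟨x, rfl⟩ := K.toLogical_surjective n G x
    obtain ⟨r, hr, h⟩ := ω.1.nonneg x.1
    refine ⟨r, hr, ?_⟩
    rw [star_toLogical, ← map_mul, toLogicalFunctional_toLogical, ← h]
    rfl
  map_one := by
    rw [← map_one (K.toLogical n G), toLogicalFunctional_toLogical]
    exact ω.1.map_one

lemma toLogicalState_toLogical (ω : K.GroundState n G) (T : ↥(K.commutant n G)) :
    (toLogicalState ω).toLinearMap (K.toLogical n G T) = ω.1.toLinearMap T :=
  toLogicalFunctional_toLogical ω T

/-- A ground state vanishes at the `X^a Z^b` outside the commutant, and its values on the commutant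
can be read off from the induced state. -/
lemma toLogicalState_injective :
    Function.Injective (toLogicalState : K.GroundState n G → State (K.LogicalAlgebra n G)) := by
  intro ω ω' h
  refine Subtype.ext (State.ext_pauli fun a b => ?_)
  by_cases hab : a ∈ K.cocycles n G ∧ b ∈ K.cycles n (DualGroup G)
  · have h1 := congrArg (fun φ => φ.toLinearMap
      (K.toLogical n G ⟨obsX a * obsZ b, pauli_mem_commutant hab.1 hab.2⟩)) h
    simpa only [toLogicalState_toLogical] using h1
  · rw [ω.map_pauli_eq_zero hab, ω'.map_pauli_eq_zero hab]

lemma toLogical_stabilizer (c : K.CellBelow n →₀ G) (d : K.cell (n + 1) →₀ DualGroup G) :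
    K.toLogical n G ⟨obsX (K.coboundaryBelow n G c) * obsZ (K.boundary n _ d),
      pauli_mem_commutant (coboundary_mem_cocycles c) (boundary_mem_cycles d)⟩ = 1 := by
  rw [← map_one (K.toLogical n G), eq_comm, toLogical_eq_iff]
  refine logicalRelations_subset ⟨0, zero_mem _, 0, zero_mem _, c, d, ?_⟩
  rw [zero_add, zero_add, obsX_zero, obsZ_zero, one_mul]
  rfl

/-- States for which all stabilizers have expectation `1` are ground states. -/
lemma isGroundState_of_map_stabilizer {ω : State (QuasiLocal (K.cell n) G)}
    (h : ∀ c d, ω.toLinearMap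
      (obsX (K.coboundaryBelow n G c) * obsZ (K.boundary n _ d)) = 1) :
    (∀ α : K.CellBelow n, ω.toLinearMap (starOperator α) = 1) ∧
    (∀ β : K.cell (n + 1), ω.toLinearMap (plaquetteOperator β) = 1) := by
  have hG : (Nat.card G : ℂ) ≠ 0 := Nat.cast_ne_zero.2 Nat.card_pos.ne'
  have _ := Fintype.ofFinite G
  have _ := Fintype.ofFinite (DualGroup G)
  have hX : ∀ c, ω.toLinearMap (obsX (K.coboundaryBelow n G c)) = 1 := fun c => by
    have := h c 0
    rwa [map_zero, obsZ_zero, mul_one] at this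
  have hZ : ∀ d, ω.toLinearMap (obsZ (K.boundary n _ d)) = 1 := fun d => by
    have := h 0 d
    rwa [map_zero, obsX_zero, one_mul] at this
  refine ⟨fun α => ?_, fun β => ?_⟩
  · rw [starOperator, map_smul, finsum_eq_sum_of_fintype, map_sum,
      Finset.sum_congr rfl fun g _ => hX _]
    simp
  · rw [plaquetteOperator, ← card_dualGroup G, map_smul, finsum_eq_sum_of_fintype, map_sum,
      Finset.sum_congr rfl fun g _ => hZ _]
    simp

/-- A state of the algebra of logical observables is a contractive functional on the commutant; by
the Hahn–Banach theorem it extends to a contractive functional on the quasi-local algebra, and such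
an extension is a state. -/
lemma toLogicalState_surjective :
    Function.Surjective (toLogicalState : K.GroundState n G → State (K.LogicalAlgebra n G)) := by
  intro φ
  let f : State ↥(K.commutant n G) :=
    { toLinearMap := φ.toLinearMap ∘ₗ (K.toLogical n G).toLinearMap
      map_one := (congrArg φ.toLinearMap (map_one (K.toLogical n G))).trans φ.map_one
      nonneg := fun x => by
        obtain ⟨r, hr, h⟩ := φ.nonneg (K.toLogical n G x)
        refine ⟨r, hr, ?_⟩
        rw [← h, star_toLogical, ← map_mul]
        rfl }
  let p : Submodule ℂ (QuasiLocal (K.cell n) G) :=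
    Subalgebra.toSubmodule (K.commutant n G).toSubalgebra
  let f' : StrongDual ℂ p := LinearMap.mkContinuous
    (show p →ₗ[ℂ] ℂ from f.toLinearMap) 1 fun x => by
      rw [one_mul]
      exact f.norm_map_le (show ↥(K.commutant n G) from x)
  obtain ⟨g, hg, hnorm⟩ := exists_extension_norm_eq p f'
  have hgf : ∀ T : ↥(K.commutant n G), g T.1 = φ.toLinearMap (K.toLogical n G T) := hg
  have hg1 : ∀ x, ‖g x‖ ≤ ‖x‖ := fun x => by
    refine (g.le_of_opNorm_le ?_ x).trans (one_mul _).le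
    rw [hnorm]
    exact LinearMap.mkContinuous_norm_le _ zero_le_one _
  let ω : State (QuasiLocal (K.cell n) G) := State.ofContractive (g : _ →ₗ[ℂ] ℂ) hg1
    ((hgf 1).trans f.map_one)
  have hω : ∀ T : ↥(K.commutant n G),
      ω.toLinearMap T.1 = φ.toLinearMap (K.toLogical n G T) := hgf
  have hground := isGroundState_of_map_stabilizer (ω := ω) fun c d =>
    (hω ⟨_, pauli_mem_commutant (coboundary_mem_cocycles c) (boundary_mem_cycles d)⟩).trans
      (by rw [toLogical_stabilizer, φ.map_one])
  let ω' : K.GroundState n G := ⟨ω, hground⟩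
  have key : (toLogicalState ω').toLinearMap = φ.toLinearMap := by
    refine LinearMap.ext fun x => ?_
    obtain ⟨T, rfl⟩ := K.toLogical_surjective n G x
    exact (toLogicalState_toLogical ω' T).trans (hω T)
  exact ⟨ω', State.ext_toLinearMap key⟩

end GroundState

end Finite

end IncidenceData

end GroundStates

/-! ### Ground states with prescribed expectations -/

section TestStates

open Filter

lemma sum_phase_hom_eq_zero {A : Type*} [AddCommGroup A] [Fintype A] {f : A →+ AddCircle (1 : ℚ)}
    {a₀ : A} (h : f a₀ ≠ 0) : ∑ a, phase (f a) = 0 := by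
  have h1 : ∑ a, phase (f a) = phase (f a₀) * ∑ a, phase (f a) := by
    rw [Finset.mul_sum, ← Equiv.sum_comp (Equiv.addLeft a₀)]
    refine Finset.sum_congr rfl fun a _ => ?_
    rw [Equiv.coe_addLeft, map_add, phase_add]
  have h2 : phase (f a₀) ≠ 1 := fun h' => h (phase_eq_one_iff.1 h')
  have h3 : (phase (f a₀) - 1) * ∑ a, phase (f a) = 0 := by
    rw [sub_mul, one_mul, ← h1, sub_self]
  exact (mul_eq_zero.1 h3).resolve_left (sub_ne_zero.2 h2)

/-- Limits of vector states along an ultrafilter: expectations that are eventually constant keep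
their value. -/
lemma exists_state_of_eventually_eq {S : Type u} {G : Type v} [AddCommGroup G] {ι : Type*}
    (l : Filter ι) [l.NeBot] (ψ : ι → HilbertSpace S G) (hψ : ∀ i, ‖ψ i‖ = 1) :
    ∃ ω : State (QuasiLocal S G), ∀ (T : QuasiLocal S G) (z : ℂ),
      (∀ᶠ i in l, inner ℂ (ψ i) (T.1 (ψ i)) = z) → ω.toLinearMap T = z := by
  let U := Ultrafilter.of l
  let f : QuasiLocal S G → ι → ℂ := fun T i => inner ℂ (ψ i) (T.1 (ψ i))
  have hex : ∀ T, ∃ z, Tendsto (f T) U (nhds z) := fun T => by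
    obtain ⟨z, -, hz⟩ := (isCompact_closedBall (0 : ℂ) ‖T.1‖).ultrafilter_le_nhds
      (U.map (f T)) (by
        rw [le_principal_iff]
        refine Filter.Eventually.of_forall (f := (U : Filter ι)) fun i => ?_
        rw [mem_closedBall_zero_iff]
        refine (norm_inner_le_norm _ _).trans ?_
        rw [hψ, one_mul]
        exact (T.1.le_opNorm _).trans (by rw [hψ, mul_one]))
    exact ⟨z, hz⟩
  choose w hw using hex
  have huniq : ∀ {T z}, Tendsto (f T) U (nhds z) → w T = z := fun h => tendsto_nhds_unique (hw _) h
  refine ⟨{ toLinearMap := { toFun := w, map_add' := fun T T' => huniq ?_,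
                             map_smul' := fun r T => huniq ?_ }
            nonneg := fun T => ?_
            map_one := huniq ?_ }, fun T z h => huniq ?_⟩
  · refine ((hw T).add (hw T')).congr fun i => ?_
    exact (inner_add_right _ _ _).symm
  · refine ((hw T).const_mul r).congr fun i => ?_
    exact (inner_smul_right _ _ _).symm
  · have hc : IsClosed {z : ℂ | 0 ≤ z.re ∧ z.im = 0} :=
      (isClosed_le continuous_const Complex.continuous_re).inter
        (isClosed_eq Complex.continuous_im continuous_const)
    have h := hc.mem_of_tendsto (hw (star T * T)) (Filter.Eventually.of_forall fun i => by
      have e : f (star T * T) i = inner ℂ (T.1 (ψ i)) (T.1 (ψ i)) :=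
        ContinuousLinearMap.adjoint_inner_right T.1 _ _
      rw [e]
      exact ⟨inner_self_nonneg (𝕜 := ℂ), inner_self_im (𝕜 := ℂ) _⟩)
    exact ⟨_, h.1, Complex.ext rfl h.2⟩
  · refine tendsto_const_nhds.congr fun i => ?_
    have e : f 1 i = inner ℂ (ψ i) (ψ i) := rfl
    rw [e, inner_self_eq_norm_sq_to_K, hψ]
    simp
  · exact tendsto_const_nhds.congr' ((h.filter_mono (Ultrafilter.of_le l)).mono fun i hi => hi.symm)

lemma norm_lp_eq_one_of_inner {S : Type u} {G : Type v} [AddCommGroup G] {ψ : HilbertSpace S G}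
    (h : inner ℂ ψ ψ = (1 : ℂ)) : ‖ψ‖ = 1 := by
  have h1 := inner_self_eq_norm_sq_to_K (𝕜 := ℂ) ψ
  rw [h] at h1
  have h2 : ‖ψ‖ ^ 2 = 1 := Complex.ofReal_injective ((Complex.ofReal_pow _ _).trans h1.symm)
  exact (pow_eq_one_iff_of_nonneg (norm_nonneg ψ) two_ne_zero).1 h2

open Classical in
/-- The normalized uniform superposition of the configurations in a coset `s + B`. -/
lemma exists_coset_vector {S : Type u} {G : Type v} [AddCommGroup G] (B : AddSubgroup (S →₀ G))
    [Finite B] (s : S →₀ G) :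
    ∃ ψ : HilbertSpace S G, ‖ψ‖ = 1 ∧ ∀ a b, inner ℂ ψ ((opX a * opZ b) ψ) =
      if a ∈ B ∧ ∀ β ∈ B, pairing b β = 0 then phase (pairing b s) else 0 := by
  have _ := Fintype.ofFinite B
  let c : ℂ := (Real.sqrt (Fintype.card B) : ℂ)⁻¹
  have hc : star c * c * Fintype.card B = 1 := by
    have h0 : (0 : ℝ) < Fintype.card B := by exact_mod_cast Fintype.card_pos
    have h1 : ((Real.sqrt (Fintype.card B) : ℂ)) ^ 2 = Fintype.card B := by
      rw [← Complex.ofReal_pow, Real.sq_sqrt h0.le, Complex.ofReal_natCast]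
    have h2 : star c = c := by simp [c]
    have h3 : (Fintype.card B : ℂ) ≠ 0 := by exact_mod_cast h0.ne'
    rw [h2, ← sq, inv_pow, h1, inv_mul_cancel₀ h3]
  let ψ : HilbertSpace S G := ∑ β : B, lp.single 2 (s + β.1) c
  have hψ : ∀ σ, ψ σ = if σ - s ∈ B then c else 0 := by
    intro σ
    have h1 : ψ σ = ∑ β : B, if σ = s + β.1 then c else 0 := by
      simp only [ψ]
      rw [lp.coeFn_sum, Finset.sum_apply]
      refine Finset.sum_congr rfl fun β _ => ?_
      rw [lp.single_apply]
      split_ifs with h <;> simp_all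
    rw [h1]
    split_ifs with h
    · rw [Finset.sum_eq_single ⟨σ - s, h⟩]
      · simp
      · intro β _ hβ
        rw [if_neg]
        rintro rfl
        exact hβ (Subtype.ext (by simp))
      · simp
    · refine Finset.sum_eq_zero fun β _ => if_neg ?_
      rintro rfl
      exact h (by simp)
  have hinner : ∀ φ : HilbertSpace S G, inner ℂ ψ φ = ∑ β : B, star c * φ (s + β.1) := by
    intro φ
    simp only [ψ]
    rw [sum_inner]
    refine Finset.sum_congr rfl fun β _ => ?_
    rw [lp.inner_single_left, RCLike.inner_apply, mul_comm]
    rfl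
  have key : ∀ a b, inner ℂ ψ ((opX a * opZ b) ψ) =
      if a ∈ B ∧ ∀ β ∈ B, pairing b β = 0 then phase (pairing b s) else 0 := by
    intro a b
    rw [hinner]
    have h1 : ∀ β : B, (opX a * opZ b) ψ (s + β.1) =
        phase (pairing b (s + β.1 - a)) * if a ∈ B then c else 0 := fun β => by
      change opX a (opZ b ψ) (s + β.1) = _
      rw [opX_apply, opZ_apply, hψ]
      congr 2
      rw [show s + β.1 - a - s = β.1 - a by abel, sub_mem_comm_iff]
      exact propext ⟨fun h => by simpa using add_mem h β.2, fun h => sub_mem h β.2⟩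
    simp only [h1]
    by_cases ha : a ∈ B
    · simp only [ha, if_true, true_and]
      have h2 : ∑ β : B, star c * (phase (pairing b (s + β.1 - a)) * c) =
          star c * c * phase (pairing b (s - a)) *
            ∑ β : B, phase (((pairing b).comp B.subtype) β) := by
        rw [Finset.mul_sum]
        refine Finset.sum_congr rfl fun β _ => ?_
        have h3 : phase (pairing b (s + β.1 - a)) =
            phase (pairing b (s - a)) * phase (((pairing b).comp B.subtype) β) := by
          rw [← phase_add, AddMonoidHom.comp_apply, AddSubgroup.subtype_apply, ← map_add]
          congr 2
          abel
        rw [h3]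
        ring
      rw [h2]
      split_ifs with hb
      · have h4 : ∀ β : B, phase (((pairing b).comp B.subtype) β) = 1 := fun β => by
          rw [AddMonoidHom.comp_apply, AddSubgroup.subtype_apply, hb _ β.2, phase_zero]
        simp only [h4, Finset.sum_const, Finset.card_univ, nsmul_eq_mul, mul_one]
        rw [map_sub, hb a ha, sub_zero, mul_right_comm, hc, one_mul]
      · push Not at hb
        obtain ⟨β, hβ, hne⟩ := hb
        rw [sum_phase_hom_eq_zero (a₀ := ⟨β, hβ⟩) hne, mul_zero]
    · simp [ha]
  refine ⟨ψ, norm_lp_eq_one_of_inner ?_, key⟩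
  have h := key 0 0
  rw [opX_zero, opZ_zero, mul_one] at h
  simpa using h

namespace IncidenceData

variable {K : IncidenceData.{u}} {n : ℕ} {G : Type v} [AddCommGroup G] [Finite G]

open Classical in
/-- Every character `f` of the chains that kills the boundaries gives a ground state in which `Z^b`
has expectation `e^{2πif(b)}` for all cycles `b`. By duality `f` is the pairing with a function `s`
from the cells to `G`, which may have infinite support; the state is the limit of the vector states
of the superpositions of the configurations `s|_Λ + ∂ᵀc` with `c` supported in `C`, as the finite
sets `C` and `Λ` grow. -/
lemma exists_groundState_of_hom (f : (K.cell n →₀ DualGroup G) →+ AddCircle (1 : ℚ))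
    (hf : ∀ d, f (K.boundary n _ d) = 0) :
    ∃ ω : K.GroundState n G, ∀ a b, ω.1.toLinearMap (obsX a * obsZ b) =
      if a ∈ (K.coboundaryBelow n G).range ∧ b ∈ K.cycles n (DualGroup G)
        then phase (f b) else 0 := by
  have hs : ∀ α, ∃ g : G, ∀ χ : DualGroup G, f (Finsupp.single α χ) = χ g := fun α =>
    exists_eq_eval (f.comp (Finsupp.singleAddHom α))
  choose s hs using hs
  let i (C : Finset (K.CellBelow n)) : (C →₀ G) →+ (K.cell n →₀ G) :=
    (K.coboundaryBelow n G).comp (Finsupp.mapDomain.addMonoidHom Subtype.val)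
  have hfin : ∀ C, Finite (i C).range := fun C => by
    have : Finite (C →₀ G) := Finite.of_injective _ DFunLike.coe_injective
    exact Set.finite_range (i C)
  have hmem : ∀ (c : K.CellBelow n →₀ G) (C : Finset (K.CellBelow n)), c.support ⊆ C →
      K.coboundaryBelow n G c ∈ (i C).range := by
    intro c C h
    refine ⟨c.subtypeDomain (· ∈ C), ?_⟩
    change K.coboundaryBelow n G (Finsupp.mapDomain Subtype.val (c.subtypeDomain (· ∈ C))) = _
    congr 1
    ext γ
    by_cases hγ : γ ∈ C
    · exact Finsupp.mapDomain_apply Subtype.val_injective _ (⟨γ, hγ⟩ : C)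
    · rw [Finsupp.mapDomain_of_notMem_range _ _ (by simpa using hγ)]
      exact (Finsupp.notMem_support_iff.1 fun h' => hγ (h h')).symm
  have hle : ∀ C, (i C).range ≤ (K.coboundaryBelow n G).range := fun C => by
    rintro _ ⟨x, rfl⟩
    exact ⟨_, rfl⟩
  choose ψ hψ hval using fun (p : Finset (K.CellBelow n) × Finset (K.cell n)) =>
    have := hfin p.1
    exists_coset_vector (i p.1).range (extendZero p.2 fun α => s α)
  obtain ⟨ω, hω⟩ := exists_state_of_eventually_eq atTop ψ hψ
  have key : ∀ a b, ω.toLinearMap (obsX a * obsZ b) =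
      if a ∈ (K.coboundaryBelow n G).range ∧ b ∈ K.cycles n (DualGroup G)
        then phase (f b) else 0 := by
    intro a b
    refine hω _ _ ?_
    have hpair : ∀ p : Finset (K.CellBelow n) × Finset (K.cell n), b.support ⊆ p.2 →
        pairing b (extendZero p.2 fun α => s α) = f b := by
      intro p hp
      conv_rhs => rw [← Finsupp.sum_single b]
      rw [pairing_apply, Finsupp.sum, Finsupp.sum, map_sum]
      refine Finset.sum_congr rfl fun α hα => ?_
      rw [hs]
      exact congrArg (b α) (extendZero_apply_mem p.2 _ ⟨α, hp hα⟩)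
    by_cases ha : a ∈ (K.coboundaryBelow n G).range
    · obtain ⟨c, hc⟩ := ha
      by_cases hb : b ∈ K.cycles n (DualGroup G)
      · rw [if_pos ⟨⟨c, hc⟩, hb⟩]
        refine (eventually_ge_atTop (c.support, b.support)).mono fun p hp => ?_
        refine (hval p a b).trans ?_
        rw [if_pos, hpair p hp.2]
        refine ⟨hc ▸ hmem c p.1 hp.1, fun β hβ => ?_⟩
        obtain ⟨c', rfl⟩ := hle _ hβ
        have hb' : K.boundaryBelow n _ b = 0 := hb
        rw [← pairing_boundaryBelow, hb', map_zero]
        rfl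
      · rw [if_neg fun h => hb h.2]
        obtain ⟨γ, hγ⟩ := Finsupp.ne_iff.1 (show K.boundaryBelow n _ b ≠ 0 from hb)
        obtain ⟨g, hg⟩ : ∃ g, K.boundaryBelow n _ b γ g ≠ 0 := by
          by_contra! h0
          exact hγ (CharacterModule.ext _ h0)
        refine (eventually_ge_atTop ({γ}, ∅)).mono fun p hp => ?_
        refine (hval p a b).trans (if_neg ?_)
        rintro ⟨-, h⟩
        have h1 := h _ (hmem (Finsupp.single γ g) p.1 (Finsupp.support_single_subset.trans hp.1))
        rw [← pairing_boundaryBelow, pairing_single_right] at h1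
        exact hg h1
    · rw [if_neg fun h => ha h.1]
      exact Eventually.of_forall fun p => (hval p a b).trans (if_neg fun h => ha (hle _ h.1))
  refine ⟨⟨ω, GroundState.isGroundState_of_map_stabilizer fun c d => ?_⟩, key⟩
  rw [key, if_pos ⟨⟨c, rfl⟩, boundary_mem_cycles d⟩, hf, phase_zero]

end IncidenceData

end TestStates

/-! ### Twisted group algebras of finite groups in duality -/

section TwistedGroupAlgebra

lemma exists_character_extension {A : Type*} [AddCommGroup A] (B : AddSubgroup A)
    (θ : DualGroup B) : ∃ θ' : DualGroup A, ∀ b : B, θ' b = θ b := by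
  obtain ⟨θ', h⟩ := CharacterModule.dual_surjective_of_injective
    B.subtype.toIntLinearMap B.subtype_injective θ
  exact ⟨θ', fun b => congrArg (fun f => f b) h⟩

lemma sum_dual_phase {A : Type*} [AddCommGroup A] [Fintype (DualGroup A)] {a : A} (ha : a ≠ 0) :
    ∑ θ : DualGroup A, phase (θ a) = 0 := by
  obtain ⟨θ₀, h⟩ := exists_dual_ne_zero ha
  exact sum_phase_hom_eq_zero (A := DualGroup A)
    (f := ({ toFun := fun θ => θ a, map_zero' := rfl, map_add' := fun _ _ => rfl } :
      DualGroup A →+ AddCircle (1 : ℚ))) (a₀ := θ₀) h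

variable {H H' : Type*} [AddCommGroup H] [AddCommGroup H']

/-- The pairing induced on the quotient of the second group by its annihilator. -/
def descend (β : H →+ H' →+ AddCircle (1 : ℚ)) :
    H →+ (H' ⧸ β.flip.ker) →+ AddCircle (1 : ℚ) where
  toFun h := QuotientAddGroup.lift _ (β h) fun y hy => by
    have := congrArg (fun f => f h) (AddMonoidHom.mem_ker.1 hy)
    exact this
  map_zero' := by
    ext y
    simp
  map_add' h h' := by
    ext y
    exact congrArg (fun f => f y) (map_add β h h')

lemma descend_mk (β : H →+ H' →+ AddCircle (1 : ℚ)) (h : H) (y : H') :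
    descend β h (y : H' ⧸ β.flip.ker) = β h y := rfl

lemma descend_ker (β : H →+ H' →+ AddCircle (1 : ℚ)) : (descend β).ker = β.ker := by
  ext h
  rw [AddMonoidHom.mem_ker, AddMonoidHom.mem_ker]
  constructor
  · intro h0
    ext y
    rw [← descend_mk, h0]
    rfl
  · intro h0
    ext y
    have : β h y = 0 := by rw [h0]; rfl
    exact this

/-- Modulo its annihilator, `H` embeds into the dual of `H'` modulo its annihilator, which has the
same order as the latter group. -/
lemma card_quotient_ker_le [Finite H'] (β : H →+ H' →+ AddCircle (1 : ℚ)) :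
    Nat.card (H ⧸ β.ker) ≤ Nat.card (H' ⧸ β.flip.ker) := by
  rw [← card_dualGroup (H' ⧸ β.flip.ker), ← descend_ker,
    Nat.card_congr (QuotientAddGroup.quotientKerEquivRange (descend β)).toEquiv]
  exact Nat.card_le_card_of_injective
    (fun x => (show DualGroup (H' ⧸ β.flip.ker) from x.1)) fun x y h => Subtype.ext h

/-- The two quotients of a pairing of finite groups by the annihilators have the same order. -/
lemma card_quotient_ker [Finite H] [Finite H'] (β : H →+ H' →+ AddCircle (1 : ℚ)) :
    Nat.card (H ⧸ β.ker) = Nat.card (H' ⧸ β.flip.ker) :=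
  (card_quotient_ker_le β).antisymm (card_quotient_ker_le β.flip)

/-- The operator `|q⟩ ↦ e^{2πi⟨h, q⟩} |y + q⟩` on functions on `H'` modulo the annihilator of `H`,
as a matrix; the index set is an enumeration of this quotient. -/
def shiftPhase (β : H →+ H' →+ AddCircle (1 : ℚ)) {ι : Type*} (ε : ι ≃ H' ⧸ β.flip.ker)
    (y : H') (h : H) : Matrix ι ι ℂ := by
  classical
  exact Matrix.of fun i j => if ε i = y + ε j then phase (descend β h (ε j)) else 0

section ShiftPhase

variable (β : H →+ H' →+ AddCircle (1 : ℚ)) {ι : Type*} (ε : ι ≃ H' ⧸ β.flip.ker)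

open Classical in
lemma shiftPhase_apply (y : H') (h : H) (i j : ι) :
    shiftPhase β ε y h i j = if ε i = y + ε j then phase (descend β h (ε j)) else 0 := rfl

lemma shiftPhase_mul [Fintype ι] (y y' : H') (h h' : H) :
    shiftPhase β ε y h * shiftPhase β ε y' h' =
      phase (β h y') • shiftPhase β ε (y + y') (h + h') := by
  classical
  ext i j
  rw [Matrix.mul_apply, Matrix.smul_apply, Finset.sum_eq_single (ε.symm (y' + ε j))]
  · simp only [shiftPhase_apply, Equiv.apply_symm_apply, if_true, QuotientAddGroup.mk_add,
      add_assoc]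
    split_ifs
    · rw [map_add, map_add, AddMonoidHom.add_apply, phase_add, phase_add, descend_mk, smul_eq_mul,
        mul_assoc]
    · simp
  · intro l _ hl
    rw [shiftPhase_apply β ε y', if_neg, mul_zero]
    intro h0
    exact hl (ε.injective (by rw [h0, Equiv.apply_symm_apply]))
  · simp

lemma shiftPhase_zero [DecidableEq ι] : shiftPhase β ε 0 0 = 1 := by
  ext i j
  rw [shiftPhase_apply, Matrix.one_apply]
  simp

lemma star_shiftPhase (y : H') (h : H) :
    star (shiftPhase β ε y h) = phase (β h y) • shiftPhase β ε (-y) (-h) := by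
  classical
  ext i j
  rw [Matrix.star_apply, Matrix.smul_apply, shiftPhase_apply, shiftPhase_apply]
  by_cases hij : ε j = y + ε i
  · rw [if_pos hij, if_pos (by rw [hij]; simp), hij, map_neg, map_add, AddMonoidHom.neg_apply,
      AddMonoidHom.neg_apply, descend_mk, smul_eq_mul, phase_add, phase_neg, phase_neg,
      ← mul_assoc, mul_comm (phase _), star_phase_mul_phase, one_mul]
  · rw [if_neg hij, if_neg]
    · simp
    · intro h0
      apply hij
      rw [h0]
      simp

/-- The trace of `shiftPhase β ε y h` vanishes unless `y` and `h` lie in the annihilators. -/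
lemma trace_shiftPhase_eq_zero [Fintype ι] {y : H'} {h : H}
    (hyh : ¬(y ∈ β.flip.ker ∧ h ∈ β.ker)) : (shiftPhase β ε y h).trace = 0 := by
  classical
  by_cases hy : y ∈ β.flip.ker
  · have hh : h ∉ (descend β).ker := fun h0 => hyh ⟨hy, descend_ker β ▸ h0⟩
    have _ := Fintype.ofEquiv ι ε
    obtain ⟨q, hq⟩ := DFunLike.ne_iff.1 hh
    rw [← sum_phase_hom_eq_zero (f := descend β h) (a₀ := q) hq, ← Equiv.sum_comp ε]
    refine Finset.sum_congr rfl fun i _ => ?_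
    rw [Matrix.diag_apply, shiftPhase_apply, if_pos]
    rw [(QuotientAddGroup.eq_zero_iff y).2 hy, zero_add]
  · refine Finset.sum_eq_zero fun i _ => ?_
    rw [Matrix.diag_apply, shiftPhase_apply, if_neg]
    intro h0
    exact hy ((QuotientAddGroup.eq_zero_iff y).1 (by simpa using h0.symm))

end ShiftPhase

/-- The characters `y ↦ θ(y)`, `h ↦ χ(h)` of the annihilators, extended to the whole groups, as
functions of the pair `(θ, χ)`. -/
lemma exists_classical_functions [Finite H] [Finite H'] (β : H →+ H' →+ AddCircle (1 : ℚ)) {k : ℕ}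
    (hk : Nat.card β.ker * Nat.card β.flip.ker = k) :
    ∃ v : H' → H → Fin k → ℂ, v 0 0 = 1 ∧
      (∀ y y' h h', v y h * v y' h' = v (y + y') (h + h')) ∧
      (∀ y h, star (v y h) = v (-y) (-h)) ∧
      ∀ y ∈ β.flip.ker, ∀ h ∈ β.ker, ¬(y = 0 ∧ h = 0) → ∑ i, v y h i = 0 := by
  classical
  have _ := Fintype.ofFinite (DualGroup β.ker)
  have _ := Fintype.ofFinite (DualGroup β.flip.ker)
  choose E hE using exists_character_extension β.flip.ker
  choose F hF using exists_character_extension β.ker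
  have hcard : Nat.card (DualGroup β.flip.ker × DualGroup β.ker) = k := by
    rw [Nat.card_prod, card_dualGroup, card_dualGroup, mul_comm, hk]
  let ε : Fin k ≃ DualGroup β.flip.ker × DualGroup β.ker := (Finite.equivFinOfCardEq hcard).symm
  refine ⟨fun y h i => phase (E (ε i).1 y) * phase (F (ε i).2 h), ?_, ?_, ?_, ?_⟩
  · ext i
    simp
  · intro y y' h h'
    ext i
    simp only [Pi.mul_apply, map_add, phase_add]
    ring
  · intro y h
    ext i
    simp only [Pi.star_apply, map_neg, phase_neg, star_mul']
  · intro y hy h hh hne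
    rw [Equiv.sum_comp ε (fun p => phase (E p.1 y) * phase (F p.2 h)), Fintype.sum_prod_type]
    have h1 : ∀ θ, phase (E θ y) = phase (θ ⟨y, hy⟩) := fun θ => by rw [← hE]
    have h2 : ∀ χ, phase (F χ h) = phase (χ ⟨h, hh⟩) := fun χ => by rw [← hF]
    simp only [h1, h2, ← Finset.sum_mul_sum]
    rw [mul_eq_zero]
    by_cases hy0 : y = 0
    · exact Or.inr (sum_dual_phase fun h0 => hne ⟨hy0, congrArg Subtype.val h0⟩)
    · exact Or.inl (sum_dual_phase fun h0 => hy0 (congrArg Subtype.val h0))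

/-- The structure of twisted group algebras: a `*`-algebra with a basis of unitaries that multiply
like `X^y Z^h` is the tensor product of a commutative algebra and a full matrix algebra. The
isomorphism sends `e (y, h)` to `(θ(y) χ(h))_{θ,χ} ⊗ shiftPhase y h`, where `(θ, χ)` runs over the
pairs of characters of the two annihilators, extended to the whole groups. -/
theorem exists_starAlgEquiv_of_basis [Finite H] [Finite H'] (β : H →+ H' →+ AddCircle (1 : ℚ))
    {A : Type*} [Ring A] [StarRing A] [Algebra ℂ A] [StarModule ℂ A]
    (e : Module.Basis (H' × H) ℂ A) (he : e (0, 0) = 1)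
    (hmul : ∀ y y' h h', e (y, h) * e (y', h') = phase (β h y') • e (y + y', h + h'))
    (hstar : ∀ y h, star (e (y, h)) = phase (β h y) • e (-y, -h)) {k N : ℕ}
    (hk : Nat.card β.ker * Nat.card β.flip.ker = k) (hN : Nat.card (H' ⧸ β.flip.ker) = N)
    {B : Type*} [Ring B] [StarRing B] [Algebra ℂ B] [StarModule ℂ B]
    (toB : Matrix (Fin N) (Fin N) ℂ ≃⋆ₐ[ℂ] B) :
    Nonempty (A ≃⋆ₐ[ℂ] (Fin k → ℂ) ⊗[ℂ] B) := by
  have _ := Fintype.ofFinite H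
  have _ := Fintype.ofFinite H'
  obtain ⟨v, hv0, hvmul, hvstar, hvsum⟩ := exists_classical_functions β hk
  let ε : Fin N ≃ H' ⧸ β.flip.ker := (Finite.equivFinOfCardEq hN).symm
  let Ψ : A →ₗ[ℂ] (Fin k → ℂ) ⊗[ℂ] B :=
    e.constr ℂ fun p => v p.1 p.2 ⊗ₜ toB (shiftPhase β ε p.1 p.2)
  have hΨ : ∀ y h, Ψ (e (y, h)) = v y h ⊗ₜ toB (shiftPhase β ε y h) := fun y h =>
    e.constr_basis _ _ _
  have hΨ1 : Ψ 1 = 1 := by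
    rw [← he, hΨ, hv0, shiftPhase_zero, map_one]
    rfl
  have hΨmul : ∀ x y, Ψ (x * y) = Ψ x * Ψ y := by
    have h : (LinearMap.mul ℂ A).compr₂ Ψ = (LinearMap.mul ℂ ((Fin k → ℂ) ⊗[ℂ] B)).compl₁₂ Ψ Ψ := by
      refine e.ext fun p => e.ext fun p' => ?_
      change Ψ (e (p.1, p.2) * e (p'.1, p'.2)) = Ψ (e (p.1, p.2)) * Ψ (e (p'.1, p'.2))
      rw [hmul, map_smul, hΨ, hΨ, hΨ, Algebra.TensorProduct.tmul_mul_tmul, hvmul, ← map_mul,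
        shiftPhase_mul, map_smul, TensorProduct.tmul_smul]
    exact fun x y => congrArg (fun f => f x y) h
  have hΨstar : ∀ x, Ψ (star x) = star (Ψ x) := by
    have h : ∀ p, Ψ (star (e p)) = star (Ψ (e p)) := fun p => by
      change Ψ (star (e (p.1, p.2))) = star (Ψ (e (p.1, p.2)))
      rw [hstar, map_smul, hΨ, hΨ, TensorProduct.star_tmul, hvstar, ← map_star, star_shiftPhase,
        map_smul, TensorProduct.tmul_smul]
    intro x
    rw [← e.sum_repr x, star_sum, map_sum, map_sum, star_sum]
    refine Finset.sum_congr rfl fun p _ => ?_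
    rw [star_smul, map_smul, map_smul, star_smul, h]
  -- the trace `τ` vanishes on all basis elements but the unit, hence detects coordinates
  let s : (Fin k → ℂ) →ₗ[ℂ] ℂ := ∑ i, LinearMap.proj i
  let tr : B →ₗ[ℂ] ℂ := Matrix.traceLinearMap (Fin N) ℂ ℂ ∘ₗ
    toB.symm.toAlgEquiv.toLinearMap
  let τ : (Fin k → ℂ) ⊗[ℂ] B →ₗ[ℂ] ℂ := LinearMap.mul' ℂ ℂ ∘ₗ TensorProduct.map s tr
  have hτ : ∀ y h, τ (Ψ (e (y, h))) = (∑ i, v y h i) * (shiftPhase β ε y h).trace := fun y h => by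
    rw [hΨ]
    change s (v y h) * (toB.symm (toB (shiftPhase β ε y h))).trace = _
    rw [StarAlgEquiv.symm_apply_apply]
    simp [s]
  have hτ0 : τ (Ψ (e (0, 0))) ≠ 0 := by
    have hkpos : k ≠ 0 := by
      rw [← hk]
      exact mul_ne_zero Nat.card_pos.ne' Nat.card_pos.ne'
    have hNpos : N ≠ 0 := by
      rw [← hN]
      exact Nat.card_pos.ne'
    rw [hτ, hv0, shiftPhase_zero, Matrix.trace_one]
    simp [hkpos, hNpos]
  have hτne : ∀ y h, ¬(y = 0 ∧ h = 0) → τ (Ψ (e (y, h))) = 0 := by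
    intro y h hne
    rw [hτ]
    by_cases hyh : y ∈ β.flip.ker ∧ h ∈ β.ker
    · rw [hvsum y hyh.1 h hyh.2 hne, zero_mul]
    · rw [trace_shiftPhase_eq_zero β ε hyh, mul_zero]
  have hinj : Function.Injective Ψ := by
    refine (injective_iff_map_eq_zero Ψ).2 fun x hx => ?_
    refine e.ext_elem fun p => ?_
    have h1 : τ (Ψ (x * e (-p.1, -p.2))) = 0 := by
      rw [hΨmul, hx, zero_mul, map_zero]
    rw [← e.sum_repr x, Finset.sum_mul, map_sum, map_sum, Finset.sum_eq_single p] at h1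
    · have h2 : e p * e (-p.1, -p.2) = phase (β p.2 (-p.1)) • e (0, 0) := by
        have := hmul p.1 (-p.1) p.2 (-p.2)
        rwa [add_neg_cancel, add_neg_cancel] at this
      rw [smul_mul_assoc, h2, map_smul, map_smul, map_smul, map_smul, smul_eq_mul,
        smul_eq_mul] at h1
      have h3 : phase (β p.2 (-p.1)) ≠ 0 :=
        norm_ne_zero_iff.1 (by rw [norm_phase]; exact one_ne_zero)
      rw [map_zero]
      exact (mul_eq_zero.1 h1).resolve_right (mul_ne_zero h3 hτ0)
    · intro p' _ hp'
      have h2 : e p' * e (-p.1, -p.2) = phase (β p'.2 (-p.1)) • e (p'.1 + -p.1, p'.2 + -p.2) :=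
        hmul p'.1 (-p.1) p'.2 (-p.2)
      rw [smul_mul_assoc, h2, map_smul, map_smul, map_smul, map_smul, hτne, smul_zero, smul_zero]
      rintro ⟨h3, h4⟩
      exact hp' (Prod.ext (add_neg_eq_zero.1 h3) (add_neg_eq_zero.1 h4))
    · simp
  have hfin : Module.Finite ℂ A := Module.Finite.of_basis e
  have hfinB : Module.Finite ℂ B := Module.Finite.equiv toB.toAlgEquiv.toLinearEquiv
  have hrank : Module.finrank ℂ A = Module.finrank ℂ ((Fin k → ℂ) ⊗[ℂ] B) := by
    have hH := AddSubgroup.card_eq_card_quotient_mul_card_addSubgroup β.ker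
    have hH' := AddSubgroup.card_eq_card_quotient_mul_card_addSubgroup β.flip.ker
    rw [card_quotient_ker, hN] at hH
    rw [hN] at hH'
    rw [Module.finrank_tensorProduct, ← toB.toAlgEquiv.toLinearEquiv.finrank_eq,
      Module.finrank_matrix, Module.finrank_eq_card_basis e, Module.finrank_fintype_fun_eq_card,
      ← Nat.card_eq_fintype_card, Nat.card_prod, hH, hH', ← hk]
    simp
    ring
  have hsurj : Function.Surjective Ψ :=
    (LinearMap.injective_iff_surjective_of_finrank_eq_finrank hrank).1 hinj
  let F : A →⋆ₐ[ℂ] (Fin k → ℂ) ⊗[ℂ] B :=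
    { toAlgHom := AlgHom.ofLinearMap Ψ hΨ1 hΨmul, map_star' := hΨstar }
  exact ⟨StarAlgEquiv.ofBijective F ⟨hinj, hsurj⟩⟩

end TwistedGroupAlgebra

/-! ### A basis of the algebra of logical observables -/

section LogicalBasis

namespace IncidenceData

variable {K : IncidenceData.{u}} {n : ℕ} {G : Type v} [AddCommGroup G]

lemma sub_mem_logicalRelations {a a' : K.cocycles n G} {b b' : K.cycles n (DualGroup G)}
    (ha : (a : K.LFCohomology n G) = a') (hb : (b : K.Homology n (DualGroup G)) = b') :
    (⟨obsX a.1 * obsZ b.1, pauli_mem_commutant a.2 b.2⟩ -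
      ⟨obsX a'.1 * obsZ b'.1, pauli_mem_commutant a'.2 b'.2⟩ : ↥(K.commutant n G)) ∈
      K.logicalRelations n G := by
  obtain ⟨c, hc⟩ := QuotientAddGroup.eq.1 ha
  obtain ⟨d, hd⟩ := QuotientAddGroup.eq.1 hb
  refine ⟨a.1, a.2, b.1, b.2, c, d, ?_⟩
  have ha' : a.1 + K.coboundaryBelow n G c = a'.1 := by
    rw [hc]
    exact add_neg_cancel_left a.1 a'.1
  have hb' : b.1 + K.boundary n _ d = b'.1 := by
    rw [hd]
    exact add_neg_cancel_left b.1 b'.1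
  rw [ha', hb']
  rfl

variable [Finite G]

/-- The class of `X^a Z^b` in the algebra of logical observables. -/
def pauliClass (a : K.cocycles n G) (b : K.cycles n (DualGroup G)) : K.LogicalAlgebra n G :=
  K.toLogical n G ⟨obsX a.1 * obsZ b.1, pauli_mem_commutant a.2 b.2⟩

lemma pauliClass_mul (a a' : K.cocycles n G) (b b' : K.cycles n (DualGroup G)) :
    pauliClass a b * pauliClass a' b' =
      phase (pairing b.1 a'.1) • pauliClass (a + a') (b + b') := by
  rw [pauliClass, pauliClass, pauliClass, ← map_mul, ← map_smul]
  congr 1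
  exact Subtype.ext (Subtype.ext (pauli_mul _ _ _ _))

lemma star_pauliClass (a : K.cocycles n G) (b : K.cycles n (DualGroup G)) :
    star (pauliClass a b) = phase (pairing b.1 a.1) • pauliClass (-a) (-b) := by
  rw [pauliClass, pauliClass, star_toLogical, ← map_smul]
  congr 1
  exact Subtype.ext (Subtype.ext (star_pauli _ _))

lemma pauliClass_zero : pauliClass (0 : K.cocycles n G) (0 : K.cycles n (DualGroup G)) = 1 := by
  rw [← map_one (K.toLogical n G), pauliClass]
  congr 1
  refine Subtype.ext ?_
  change obsX 0 * obsZ 0 = 1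
  rw [obsX_zero, obsZ_zero, mul_one]

lemma pauliClass_eq {a a' : K.cocycles n G} {b b' : K.cycles n (DualGroup G)}
    (ha : (a : K.LFCohomology n G) = a') (hb : (b : K.Homology n (DualGroup G)) = b') :
    pauliClass a b = pauliClass a' b' :=
  (toLogical_eq_iff K n G _ _).2 (logicalRelations_subset (sub_mem_logicalRelations ha hb))

/-- The class of `X^a Z^b`, as a function of the (co)homology classes of `a` and `b`, by means of
chosen representatives; `logicalPauli_mk` shows that the choice does not matter. -/
def logicalPauli (p : K.LFCohomology n G × K.Homology n (DualGroup G)) : K.LogicalAlgebra n G :=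
  pauliClass p.1.out p.2.out

lemma logicalPauli_mk (a : K.cocycles n G) (b : K.cycles n (DualGroup G)) :
    logicalPauli ((a : K.LFCohomology n G), (b : K.Homology n (DualGroup G))) = pauliClass a b :=
  pauliClass_eq (QuotientAddGroup.out_eq' _) (QuotientAddGroup.out_eq' _)

lemma logicalPauli_zero : logicalPauli (0 : K.LFCohomology n G × K.Homology n (DualGroup G)) = 1 :=
  (logicalPauli_mk 0 0).trans pauliClass_zero

lemma logicalPauli_mul (y y' : K.LFCohomology n G) (h h' : K.Homology n (DualGroup G)) :
    logicalPauli (y, h) * logicalPauli (y', h') =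
      phase (K.homologyPairing n G h y') • logicalPauli (y + y', h + h') := by
  obtain ⟨a, rfl⟩ := QuotientAddGroup.mk_surjective y
  obtain ⟨a', rfl⟩ := QuotientAddGroup.mk_surjective y'
  obtain ⟨b, rfl⟩ := QuotientAddGroup.mk_surjective h
  obtain ⟨b', rfl⟩ := QuotientAddGroup.mk_surjective h'
  rw [← QuotientAddGroup.mk_add, ← QuotientAddGroup.mk_add, logicalPauli_mk, logicalPauli_mk,
    logicalPauli_mk, pauliClass_mul, homologyPairing_mk]

lemma star_logicalPauli (y : K.LFCohomology n G) (h : K.Homology n (DualGroup G)) :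
    star (logicalPauli (y, h)) = phase (K.homologyPairing n G h y) • logicalPauli (-y, -h) := by
  obtain ⟨a, rfl⟩ := QuotientAddGroup.mk_surjective y
  obtain ⟨b, rfl⟩ := QuotientAddGroup.mk_surjective h
  rw [← QuotientAddGroup.mk_neg, ← QuotientAddGroup.mk_neg, logicalPauli_mk, logicalPauli_mk,
    star_pauliClass, homologyPairing_mk]

open Classical in
/-- For a character `χ` of the homology group there is a functional with value `χ` on the classes
of the `Z^b` and `0` on the `X^a Z^b` with `a` not a coboundary. It comes from the ground state
whose `Z`-expectations are given by an extension of `χ` to all chains. -/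
lemma exists_functional (χ : DualGroup (K.Homology n (DualGroup G))) :
    ∃ φ : K.LogicalAlgebra n G →ₗ[ℂ] ℂ, ∀ y h,
      φ (logicalPauli (y, h)) = if y = 0 then phase (χ h) else 0 := by
  obtain ⟨f, hf⟩ := exists_character_extension (K.cycles n (DualGroup G))
    ((show K.Homology n (DualGroup G) →+ AddCircle (1 : ℚ) from χ).comp
      (QuotientAddGroup.mk' _) : DualGroup (K.cycles n (DualGroup G)))
  have hf' : ∀ b : K.cycles n (DualGroup G), f b = χ (b : K.Homology n (DualGroup G)) := hf
  obtain ⟨ω, hω⟩ := exists_groundState_of_hom (K := K) (n := n) (G := G)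
    (show (K.cell n →₀ DualGroup G) →+ AddCircle (1 : ℚ) from f) fun d => by
      have h0 : ((⟨_, boundary_mem_cycles d⟩ : K.cycles n (DualGroup G)) :
          K.Homology n (DualGroup G)) = 0 :=
        (QuotientAddGroup.eq_zero_iff _).2 (AddSubgroup.mem_addSubgroupOf.2 ⟨d, rfl⟩)
      refine (hf' ⟨_, boundary_mem_cycles d⟩).trans ?_
      rw [h0, map_zero]
  refine ⟨ω.toLogicalFunctional, fun y h => ?_⟩
  obtain ⟨a, rfl⟩ := QuotientAddGroup.mk_surjective y
  obtain ⟨b, rfl⟩ := QuotientAddGroup.mk_surjective h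
  rw [logicalPauli_mk, pauliClass, GroundState.toLogicalFunctional_toLogical]
  refine (hω _ _).trans ?_
  rw [← hf']
  refine if_congr ?_ rfl rfl
  rw [QuotientAddGroup.eq_zero_iff]
  exact ⟨fun h => h.1, fun h => ⟨h, b.2⟩⟩

variable [Finite (K.Homology n (DualGroup G))] [Finite (K.LFCohomology n G)]

/-- The functionals of `exists_functional`, composed with multiplication by the class of `X^{-a}`,
give the Fourier transform of the coefficients at a fixed cohomology class. -/
lemma linearIndependent_logicalPauli : LinearIndependent ℂ
    (logicalPauli : K.LFCohomology n G × K.Homology n (DualGroup G) → K.LogicalAlgebra n G) := by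
  classical
  have _ := Fintype.ofFinite (K.Homology n (DualGroup G))
  have _ := Fintype.ofFinite (K.LFCohomology n G)
  have _ := Fintype.ofFinite (DualGroup (K.Homology n (DualGroup G)))
  refine Fintype.linearIndependent_iff.2 fun g hg p => ?_
  obtain ⟨y₀, h₀⟩ := p
  have h1 : ∀ χ : DualGroup (K.Homology n (DualGroup G)),
      ∑ h, g (y₀, h) * phase (χ h) = 0 := by
    intro χ
    obtain ⟨φ, hφ⟩ := exists_functional χ
    have h2 := congrArg (fun x => φ (logicalPauli (-y₀, 0) * x)) hg
    simp only [Finset.mul_sum, mul_smul_comm, map_sum, map_smul, mul_zero, map_zero] at h2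
    rw [Fintype.sum_prod_type, Finset.sum_eq_single y₀] at h2
    · rw [← h2]
      refine Finset.sum_congr rfl fun h _ => ?_
      rw [logicalPauli_mul, map_smul, hφ, if_pos (neg_add_cancel y₀)]
      simp
    · intro y _ hy
      refine Finset.sum_eq_zero fun h _ => ?_
      rw [logicalPauli_mul, map_smul, hφ, if_neg, smul_zero, smul_zero]
      intro h0
      exact hy (neg_add_eq_zero.1 h0).symm
    · simp
  have h3 : ∑ χ : DualGroup (K.Homology n (DualGroup G)),
      phase (χ (-h₀)) * ∑ h, g (y₀, h) * phase (χ h) = 0 :=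
    Finset.sum_eq_zero fun χ _ => by rw [h1, mul_zero]
  simp only [Finset.mul_sum] at h3
  rw [Finset.sum_comm, Finset.sum_eq_single h₀] at h3
  · have h4 : ∀ χ : DualGroup (K.Homology n (DualGroup G)),
        phase (χ (-h₀)) * (g (y₀, h₀) * phase (χ h₀)) = g (y₀, h₀) := fun χ => by
      rw [mul_left_comm, map_neg, phase_neg, star_phase_mul_phase, mul_one]
    simp only [h4, Finset.sum_const, Finset.card_univ, nsmul_eq_mul] at h3
    exact (mul_eq_zero.1 h3).resolve_left (Nat.cast_ne_zero.2 Fintype.card_ne_zero)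
  · intro h _ hne
    have h4 : ∀ χ : DualGroup (K.Homology n (DualGroup G)),
        phase (χ (-h₀)) * (g (y₀, h) * phase (χ h)) = g (y₀, h) * phase (χ (-h₀ + h)) :=
      fun χ => by rw [map_add, phase_add, mul_left_comm]
    simp only [h4, ← Finset.mul_sum]
    rw [sum_dual_phase, mul_zero]
    exact fun h0 => hne (neg_add_eq_zero.1 h0).symm
  · simp

/-- Modulo `J` the commutant is spanned by the finitely many representatives: their span `F` is
finite-dimensional, so `J + F` is closed, and it contains all `X^a Z^b` of the commutant. -/
lemma span_logicalPauli : ⊤ ≤ Submodule.span ℂ (Set.range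
    (logicalPauli : K.LFCohomology n G × K.Homology n (DualGroup G) → K.LogicalAlgebra n G)) := by
  rintro x -
  obtain ⟨T, rfl⟩ := K.toLogical_surjective n G x
  let P : K.LFCohomology n G × K.Homology n (DualGroup G) → ↥(K.commutant n G) := fun p =>
    ⟨obsX p.1.out.1 * obsZ p.2.out.1, pauli_mem_commutant p.1.out.2 p.2.out.2⟩
  let F : Submodule ℂ ↥(K.commutant n G) := Submodule.span ℂ (Set.range P)
  have hF : FiniteDimensional ℂ F := FiniteDimensional.span_of_finite ℂ (Set.finite_range P)
  have hclosed : IsClosed ((K.logicalSubspace n G ⊔ F : Submodule ℂ ↥(K.commutant n G)) :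
      Set ↥(K.commutant n G)) :=
    Submodule.isClosed_sup_finiteDimensional _ _ isClosed_logicalSubspace
  have hle : Submodule.span ℂ (K.cycleElements n G) ≤ K.logicalSubspace n G ⊔ F := by
    refine Submodule.span_le.2 ?_
    rintro V ⟨a, ha, b, hb, hV⟩
    let y : K.LFCohomology n G := ((⟨a, ha⟩ : K.cocycles n G) : K.LFCohomology n G)
    let h : K.Homology n (DualGroup G) :=
      ((⟨b, hb⟩ : K.cycles n (DualGroup G)) : K.Homology n (DualGroup G))
    have e : V = (⟨obsX a * obsZ b, pauli_mem_commutant ha hb⟩ - P (y, h)) + P (y, h) := by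
      rw [sub_add_cancel]
      exact Subtype.ext hV
    rw [e]
    refine add_mem (Submodule.mem_sup_left (logicalRelations_subset ?_))
      (Submodule.mem_sup_right (Submodule.subset_span ⟨_, rfl⟩))
    exact sub_mem_logicalRelations (a := ⟨a, ha⟩) (b := ⟨b, hb⟩)
      (QuotientAddGroup.out_eq' y).symm (QuotientAddGroup.out_eq' h).symm
  obtain ⟨j, hj, f, hf, rfl⟩ := Submodule.mem_sup.1
    (closure_minimal hle hclosed (mem_closure_cycleElements T))
  have h0 : K.toLogical n G j = 0 := by
    rw [← map_zero (K.toLogical n G), toLogical_eq_iff, sub_zero]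
    exact hj
  rw [map_add, h0, zero_add]
  have hFle : F ≤ (Submodule.span ℂ (Set.range (logicalPauli : K.LFCohomology n G ×
      K.Homology n (DualGroup G) → K.LogicalAlgebra n G))).comap
      (K.toLogical n G).toLinearMap := by
    refine Submodule.span_le.2 ?_
    rintro _ ⟨p, rfl⟩
    exact Submodule.subset_span ⟨p, rfl⟩
  exact hFle hf

variable (K n G) in
/-- The basis of the algebra of logical observables formed by the classes of the `X^a Z^b`. -/
def logicalBasis : Module.Basis (K.LFCohomology n G × K.Homology n (DualGroup G)) ℂ
    (K.LogicalAlgebra n G) :=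
  Module.Basis.mk linearIndependent_logicalPauli span_logicalPauli

lemma logicalBasis_apply (p : K.LFCohomology n G × K.Homology n (DualGroup G)) :
    logicalBasis K n G p = logicalPauli p :=
  Module.Basis.mk_apply _ _ p

end IncidenceData

end LogicalBasis

/-! ### The numbers of classical bits and qubits -/

section Counting

namespace IncidenceData

variable {K : IncidenceData.{u}} {n : ℕ} {G : Type v} [AddCommGroup G]
  [Finite (K.Homology n (DualGroup G))] [Finite (K.LFCohomology n G)]

lemma two_rpow_classicalBits : (2 : ℝ) ^ K.classicalBits n G =
    ((Nat.card (K.homologyPairing n G).ker * Nat.card (K.homologyPairing n G).flip.ker : ℕ) :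
      ℝ) := by
  have e1 : {b : K.Homology n (DualGroup G) |
      ∀ a : K.LFCohomology n G, K.homologyPairing n G b a = 0} = (K.homologyPairing n G).ker := by
    ext b
    exact ⟨fun h => AddMonoidHom.ext h, fun h a => congrArg (fun f => f a) h⟩
  have e2 : {a : K.LFCohomology n G | ∀ b : K.Homology n (DualGroup G),
      K.homologyPairing n G b a = 0} = (K.homologyPairing n G).flip.ker := by
    ext a
    exact ⟨fun h => AddMonoidHom.ext h, fun h b => congrArg (fun f => f b) h⟩
  have h1 : (0 : ℝ) < Nat.card (K.homologyPairing n G).ker := Nat.cast_pos.2 Nat.card_pos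
  have h2 : (0 : ℝ) < Nat.card (K.homologyPairing n G).flip.ker := Nat.cast_pos.2 Nat.card_pos
  rw [classicalBits, e1, e2, Real.rpow_add two_pos, Nat.cast_mul]
  exact congrArg₂ _ (Real.rpow_logb two_pos (by norm_num) h1)
    (Real.rpow_logb two_pos (by norm_num) h2)

/-- The two quotients by the annihilators have the same order `N`, so that
`|H_n| · |H^n_lf| = 2^c · N²`. -/
lemma two_rpow_qubits : (2 : ℝ) ^ K.qubits n G =
    (Nat.card (K.LFCohomology n G ⧸ (K.homologyPairing n G).flip.ker) : ℝ) := by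
  set β := K.homologyPairing n G
  have hN : (0 : ℝ) < Nat.card (K.LFCohomology n G ⧸ β.flip.ker) := Nat.cast_pos.2 Nat.card_pos
  have h : (0 : ℝ) < Nat.card (K.Homology n (DualGroup G) × K.LFCohomology n G) :=
    Nat.cast_pos.2 Nat.card_pos
  have hc := two_rpow_classicalBits (K := K) (n := n) (G := G)
  have hsq : ((2 : ℝ) ^ K.qubits n G) ^ 2 =
      (Nat.card (K.LFCohomology n G ⧸ β.flip.ker) : ℝ) ^ 2 := by
    have h1 : (0 : ℝ) < (2 : ℝ) ^ K.classicalBits n G := Real.rpow_pos_of_pos two_pos _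
    rw [← Real.rpow_natCast, ← Real.rpow_mul two_pos.le, qubits, Nat.cast_ofNat,
      div_mul_cancel₀ _ two_ne_zero, Real.rpow_sub two_pos,
      Real.rpow_logb two_pos (by norm_num) h, div_eq_iff h1.ne', hc]
    have hH := AddSubgroup.card_eq_card_quotient_mul_card_addSubgroup β.ker
    have hH' := AddSubgroup.card_eq_card_quotient_mul_card_addSubgroup β.flip.ker
    rw [card_quotient_ker] at hH
    rw [Nat.card_prod, hH, hH']
    push_cast
    ring
  exact (pow_left_inj₀ (Real.rpow_nonneg two_pos.le _) hN.le two_ne_zero).1 hsq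

end IncidenceData

end Counting

end KitaevModel

end

theorem theorem6p4 {X : Type u} [TopologicalSpace X] [T2Space X] (E : Set X)
    [Topology.CWComplex E] (o : KitaevModel.CellOrientation E) (ho : o.LocallyFinite)
    (G : Type v) [AddCommGroup G] [Finite G] (n : ℕ)
    [Finite ((o.toIncidenceData ho).Homology n (KitaevModel.DualGroup G))]
    [Finite ((o.toIncidenceData ho).LFCohomology n G)] :
    (∃ Φ : (o.toIncidenceData ho).GroundState n G ≃
        KitaevModel.State ((o.toIncidenceData ho).LogicalAlgebra n G),
      ∀ (ω : (o.toIncidenceData ho).GroundState n G)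
        (T : (o.toIncidenceData ho).commutant n G),
        (Φ ω).toLinearMap ((o.toIncidenceData ho).toLogical n G T) = ω.1.toLinearMap T) ∧
    ∃ k N : ℕ,
      (k : ℝ) = (2 : ℝ) ^ (o.toIncidenceData ho).classicalBits n G ∧
      (N : ℝ) = (2 : ℝ) ^ (o.toIncidenceData ho).qubits n G ∧
      Nonempty ((o.toIncidenceData ho).LogicalAlgebra n G ≃⋆ₐ[ℂ]
        (Fin k → ℂ) ⊗[ℂ]
          (EuclideanSpace ℂ (Fin N) →L[ℂ] EuclideanSpace ℂ (Fin N))) := by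
  open KitaevModel IncidenceData in
  exact ⟨⟨Equiv.ofBijective _ ⟨GroundState.toLogicalState_injective,
      GroundState.toLogicalState_surjective⟩, GroundState.toLogicalState_toLogical⟩,
    _, _, two_rpow_classicalBits.symm, two_rpow_qubits.symm,
    exists_starAlgEquiv_of_basis _ (logicalBasis _ n G)
      ((logicalBasis_apply _).trans logicalPauli_zero)
      (fun y y' h h' => by
        simp only [logicalBasis_apply]
        exact logicalPauli_mul y y' h h')
      (fun y h => by
        simp only [logicalBasis_apply]
        exact star_logicalPauli y h)
      rfl rfl Matrix.toEuclideanCLM⟩
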